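/- Let $E=x\partial_x+y\partial_y$ and $T=-y\partial_x+x\partial_y$ on $\mathbb R^3$, and let $\pi=T\wedge\partial_z$, the linear Poisson structure on $\mathfrak e(2)^*\cong\mathbb R^3$ (so $[\pi,\pi]=0$). Let $H^k=H^k(\mathbb R^3,\pi)$ be the Poisson cohomology, i.e. the cohomology of $(\mathfrak X^\bullet(\mathbb R^3),\ \mathrm d_\pi=[\pi,\cdot\,])$, where $[\cdot,\cdot]$ is the Schouten–Nijenhuis bracket (with $[X,f]=X(f)$) on smooth multivector fields. Then: * $H^0$: the Casimir functions are exactly the functions $f(x^2+y^2)$ with $f\in C^\infty([0,\infty))$, and $f$ is unique. * $H^1$ is a free module over the algebra of Casimir functions with basis the classes of $E$ and $\partial_z$. * $H^2$: for all $f\in C^\infty([0,\infty))$ and $g\in C^\infty(\mathbb R)$ the bivector field $f(x^2+y^2)\,E\wedge\partial_z+g(z)\,\partial_x\wedge\partial_y$ is a cocycle, and every class in $H^2$ is represented by exactly one of these. * $H^3$: every class is represented by $g(z)\,\partial_x\wedge\partial_y\wedge\partial_z$ for exactly one $g\in C^\infty(\mathbb R)$. The algebraic structure (wedge product and Schouten–Nijenhuis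 bracket) is described by the following relations in cohomology: for every $h\in C^\infty([0,\infty)\times\mathbb R)$ the fields below are cocycles and $$[h(x^2+y^2,z)\,\partial_x\wedge\partial_y]=[h(0,z)\,\partial_x\wedge\partial_y],\qquad [h(x^2+y^2,z)\,\partial_x\wedge\partial_y\wedge\partial_z]=[h(0,z)\,\partial_x\wedge\partial_y\wedge\partial_z].$$ Explicitly, for Casimirs $u,a,b,a',b',c,c'$ and $g,g'\in C^\infty(\mathbb R)$ (of the variable $z$), with $u_0,a_0,\dots$ the values of the Casimirs at the origin, $\dot g=dg/dz$ and $\sim$ meaning equality of cohomology classes: $$u\,(c\,E\wedge\partial_z+g\,\partial_x\wedge\partial_y)\sim uc\,E\wedge\partial_z+u_0g\,\partial_x\wedge\partial_y,\qquad u\,g\,\partial_x\wedge\partial_y\wedge\partial_z\sim u_0g\,\partial_x\wedge\partial_y\wedge\partial_z,$$ $$(aE+b\partial_z)\wedge(a'E+b'\partial_z)\sim(ab'-ba')\,E\wedge\partial_z,\qquad (aE+b\partial_z)\wedge(c\,E\wedge\partial_z+g\,\partial_x\wedge\partial_y)\sim b_0g\,\partial_x\wedge\partial_y\wedge\partial_z,$$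 $$[aE+b\partial_z,u]\sim aE(u),\qquad [u,\,c\,E\wedge\partial_z+g\,\partial_x\wedge\partial_y]\sim -cE(u)\,\partial_z,\qquad [u,\,g\,\partial_x\wedge\partial_y\wedge\partial_z]\sim0,$$ $$[aE+b\partial_z,a'E+b'\partial_z]\sim(aE(a')-a'E(a))E+(aE(b')-a'E(b))\partial_z,$$ $$[aE+b\partial_z,\,c\,E\wedge\partial_z+g\,\partial_x\wedge\partial_y]\sim(aE(c)-cE(a))\,E\wedge\partial_z+(b_0\dot g-2a_0g)\,\partial_x\wedge\partial_y,$$ $$[aE+b\partial_z,\,g\,\partial_x\wedge\partial_y\wedge\partial_z]\sim(b_0\dot g-2a_0g)\,\partial_x\wedge\partial_y\wedge\partial_z,$$ $$[c\,E\wedge\partial_z+g\,\partial_x\wedge\partial_y,\ c'E\wedge\partial_z+g'\,\partial_x\wedge\partial_y]\sim 2(c_0g'+c'_0g)\,\partial_x\wedge\partial_y\wedge\partial_z.$$ -/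

import Mathlib

open scoped ContDiff

noncomputable section

namespace PoissonCoh

/-- The smooth functions as a subalgebra of all functions `ℝⁿ → ℝ`. -/
def smoothSubalgebra (n : ℕ) : Subalgebra ℝ ((Fin n → ℝ) → ℝ) where
  carrier := {f | ContDiff ℝ ∞ f}
  mul_mem' hf hg := by
    rw [Set.mem_ofPred_eq] at *; exact hf.mul hg
  add_mem' hf hg := by
    rw [Set.mem_ofPred_eq] at *; exact hf.add hg
  algebraMap_mem' _ := by
    rw [Set.mem_ofPred_eq]; exact contDiff_const

/-- The algebra `C^∞(ℝⁿ)` of smooth real functions. -/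
def Smooth (n : ℕ) : Type := smoothSubalgebra n

instance (n : ℕ) : CommRing (Smooth n) := inferInstanceAs (CommRing (smoothSubalgebra n))

instance (n : ℕ) : Algebra ℝ (Smooth n) := inferInstanceAs (Algebra ℝ (smoothSubalgebra n))

lemma Smooth.ext {n : ℕ} {f g : Smooth n} (h : ∀ x, f.1 x = g.1 x) : f = g :=
  Subtype.ext (funext h)

lemma mem_smooth {n : ℕ} {f : (Fin n → ℝ) → ℝ} :
    f ∈ smoothSubalgebra n ↔ ContDiff ℝ ∞ f := Iff.rfl

lemma smooth_contDiff {n : ℕ} (f : Smooth n) : ContDiff ℝ ∞ f.1 := mem_smooth.1 f.2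

lemma smooth_differentiableAt {n : ℕ} (f : Smooth n) (x : Fin n → ℝ) :
    DifferentiableAt ℝ f.1 x :=
  (smooth_contDiff f).differentiable (by simp) x

/-- The partial derivative `∂/∂xᵢ` as a derivation of `C^∞(ℝⁿ)`. -/
def pd {n : ℕ} (i : Fin n) : Derivation ℝ (Smooth n) (Smooth n) where
  toFun f := ⟨fun x => fderiv ℝ f.1 x (Pi.single i 1),
    mem_smooth.2 (((smooth_contDiff f).fderiv_right (m := ∞) (by simp)).clm_apply contDiff_const)⟩
  map_add' f g := by
    refine Smooth.ext fun x => ?_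
    change fderiv ℝ (f.1 + g.1) x _ = _
    rw [fderiv_add (smooth_differentiableAt f x) (smooth_differentiableAt g x)]; rfl
  map_smul' c f := by
    refine Smooth.ext fun x => ?_
    change fderiv ℝ (c • f.1) x _ = _
    rw [fderiv_const_smul (smooth_differentiableAt f x)]; rfl
  map_one_eq_zero' := by
    refine Smooth.ext fun x => ?_
    change fderiv ℝ (fun _ => (1 : ℝ)) x _ = 0
    simp
  leibniz' f g := by
    refine Smooth.ext fun x => ?_
    change fderiv ℝ (f.1 * g.1) x _ = _
    rw [fderiv_mul (smooth_differentiableAt f x) (smooth_differentiableAt g x)]; rfl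

/-- Multivector fields on `ℝⁿ` (of mixed degree).  `P I` is the coefficient of
`∂_I = ∂_{i₁} ∧ ⋯ ∧ ∂_{iₖ}`, where `I = {i₁ < ⋯ < iₖ}`. -/
abbrev MultiVF (n : ℕ) : Type := Finset (Fin n) → Smooth n

/-- The coordinate multivector field `∂_I`. -/
def dd {n : ℕ} (I : Finset (Fin n)) : MultiVF n := Pi.single I 1

/-- A function as a multivector field of degree `0`. -/
def ofFun {n : ℕ} (f : Smooth n) : MultiVF n := Pi.single ∅ f

/-- Multivector fields of degree `k`. -/
def homog (n k : ℕ) : Submodule (Smooth n) (MultiVF n) where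
  carrier := {P | ∀ I, I.card ≠ k → P I = 0}
  add_mem' hP hQ I hI := by simp [hP I hI, hQ I hI]
  zero_mem' _ _ := rfl
  smul_mem' c P hP I hI := by simp [hP I hI]

/-- The sign with `∂_I ∧ ∂_J = ε(I, J) ∂_{I ∪ J}` for disjoint `I` and `J`. -/
def shuffleSign {n : ℕ} (I J : Finset (Fin n)) : ℤ :=
  (-1) ^ ((I ×ˢ J).filter fun p => p.2 < p.1).card

/-- The wedge product. -/
def wedge {n : ℕ} (P Q : MultiVF n) : MultiVF n := fun K =>
  ∑ I ∈ K.powerset, shuffleSign I (K \ I) • (P I * Q (K \ I))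

/-- The left derivative in the odd variable `∂ᵢ`: it sends `∂ᵢ ∧ ∂_J` to `∂_J` and kills
`∂_J`, for `i ∉ J`. -/
def leftD {n : ℕ} (i : Fin n) (P : MultiVF n) : MultiVF n := fun J =>
  if i ∈ J then 0 else shuffleSign {i} J • P (insert i J)

/-- The right derivative in the odd variable `∂ᵢ`: it sends `∂_J ∧ ∂ᵢ` to `∂_J` and kills
`∂_J`, for `i ∉ J`. -/
def rightD {n : ℕ} (i : Fin n) (P : MultiVF n) : MultiVF n := fun J =>
  if i ∈ J then 0 else shuffleSign J {i} • P (insert i J)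

/-- `∂/∂xᵢ` applied to all coefficients. -/
def coeffD {n : ℕ} (i : Fin n) (P : MultiVF n) : MultiVF n := fun J => pd i (P J)

/-- The Schouten-Nijenhuis bracket
`[P, Q] = ∑ᵢ (P ∂/∂ξᵢ) ∧ (∂Q/∂xᵢ) - (∂P/∂xᵢ) ∧ (∂/∂ξᵢ Q)`, with `ξᵢ = ∂ᵢ`, `P ∂/∂ξᵢ` the
right and `∂/∂ξᵢ Q` the left derivative.  It satisfies `[X, f] = X(f)`, it is the Lie bracket
on vector fields, and
`[P, Q ∧ R] = [P, Q] ∧ R + (-1) ^ ((p - 1) q) Q ∧ [P, R]`. -/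
def schouten {n : ℕ} (P Q : MultiVF n) : MultiVF n :=
  ∑ i, (wedge (rightD i P) (coeffD i Q) - wedge (coeffD i P) (leftD i Q))

/-- Poisson structures: bivector fields `π` with `[π, π] = 0`. -/
def IsPoisson {n : ℕ} (π : MultiVF n) : Prop := π ∈ homog n 2 ∧ schouten π π = 0

section algebra

variable {n : ℕ}

lemma wedge_add (P Q R : MultiVF n) : wedge P (Q + R) = wedge P Q + wedge P R := by
  funext K
  simp [wedge, mul_add, Finset.sum_add_distrib]

lemma wedge_smul (f : Smooth n) (P Q : MultiVF n) : wedge P (f • Q) = f • wedge P Q := by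
  funext K
  simp only [wedge, Pi.smul_apply, smul_eq_mul, Finset.mul_sum]
  refine Finset.sum_congr rfl fun I _ => ?_
  rw [mul_smul_comm]; congr 1; ring

lemma smul_wedge (f : Smooth n) (P Q : MultiVF n) : wedge (f • P) Q = f • wedge P Q := by
  funext K
  simp only [wedge, Pi.smul_apply, smul_eq_mul, Finset.mul_sum]
  refine Finset.sum_congr rfl fun I _ => ?_
  rw [mul_smul_comm]; congr 1; ring

lemma sum_wedge {ι : Type*} (s : Finset ι) (P : ι → MultiVF n) (Q : MultiVF n) :
    wedge (∑ i ∈ s, P i) Q = ∑ i ∈ s, wedge (P i) Q := by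
  funext K
  simp only [wedge, Finset.sum_apply, Finset.sum_mul, Finset.smul_sum]
  rw [Finset.sum_comm]

lemma wedge_ofFun (f : Smooth n) (P : MultiVF n) : wedge P (ofFun f) = f • P := by
  funext K
  rw [wedge, Finset.sum_eq_single K]
  · simp [ofFun, shuffleSign, mul_comm]
  · intro I hI hne
    have : K \ I ≠ ∅ := fun h =>
      hne (Finset.Subset.antisymm (Finset.mem_powerset.1 hI) (Finset.sdiff_eq_empty_iff_subset.1 h))
    simp [ofFun, this]
  · simp

lemma schouten_add (π P Q : MultiVF n) :
    schouten π (P + Q) = schouten π P + schouten π Q := by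
  have h1 : ∀ i, coeffD i (P + Q) = coeffD i P + coeffD i Q := fun i => by
    funext J; simp [coeffD]
  have h2 : ∀ i, leftD i (P + Q) = leftD i P + leftD i Q := fun i => by
    funext J; by_cases h : i ∈ J <;> simp [leftD, h]
  simp only [schouten, ← Finset.sum_add_distrib]
  refine Finset.sum_congr rfl fun i _ => ?_
  rw [h1, h2, wedge_add, wedge_add]; abel

lemma schouten_ofFun (π : MultiVF n) (f : Smooth n) :
    schouten π (ofFun f) = ∑ i, pd i f • rightD i π := by
  refine Finset.sum_congr rfl fun i _ => ?_
  have h1 : coeffD i (ofFun f) = ofFun (pd i f) := by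
    funext J; by_cases h : J = ∅ <;> simp [coeffD, ofFun, h]
  have h2 : leftD i (ofFun f) = (0 : Smooth n) • ofFun f := by
    funext J; by_cases h : i ∈ J <;> simp [leftD, ofFun, Pi.single_apply, h]
  rw [h1, h2, wedge_smul, zero_smul, sub_zero, wedge_ofFun]

lemma schouten_smul (π P : MultiVF n) (f : Smooth n) :
    schouten π (f • P) = f • schouten π P + wedge (schouten π (ofFun f)) P := by
  have h1 : ∀ i, coeffD i (f • P) = f • coeffD i P + pd i f • P := fun i => by
    funext J; simp [coeffD, mul_comm]
  have h2 : ∀ i, leftD i (f • P) = f • leftD i P := fun i => by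
    funext J; by_cases h : i ∈ J <;> simp [leftD, h, mul_left_comm]
  rw [schouten_ofFun, sum_wedge, schouten, schouten, Finset.smul_sum, ← Finset.sum_add_distrib]
  refine Finset.sum_congr rfl fun i _ => ?_
  rw [h1, h2, wedge_add, wedge_smul, wedge_smul, wedge_smul, smul_wedge, smul_sub]; abel

end algebra

/-- The algebra of Casimir functions, `{f | [π, f] = 0}`. -/
def casimirs {n : ℕ} (π : MultiVF n) : Subalgebra ℝ (Smooth n) where
  carrier := {f | schouten π (ofFun f) = 0}
  mul_mem' {f g} hf hg := by
    simp only [Set.mem_ofPred_eq, schouten_ofFun] at *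
    simp only [Derivation.leibniz, add_smul, smul_assoc, Finset.sum_add_distrib,
      ← Finset.smul_sum, hf, hg, smul_zero, add_zero]
  add_mem' {f g} hf hg := by
    simp only [Set.mem_ofPred_eq, schouten_ofFun] at *
    simp only [map_add, add_smul, Finset.sum_add_distrib, hf, hg, add_zero]
  algebraMap_mem' r := by
    simp [schouten_ofFun]

lemma schouten_casimir_smul {n : ℕ} (π P : MultiVF n) (f : casimirs π) :
    schouten π (f • P) = f • schouten π P := by
  have h : schouten π (ofFun (f : Smooth n)) = 0 := f.2
  have h0 : wedge (0 : MultiVF n) P = 0 := by funext K; simp [wedge]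
  have := schouten_smul π P (f : Smooth n)
  rw [h, h0, add_zero] at this
  exact this

/-- `k`-cocycles of the Poisson complex `(𝔛^•(ℝⁿ), d_π = [π, ·])`, as a module over the
Casimirs. -/
def cocycles {n : ℕ} (π : MultiVF n) (k : ℕ) : Submodule (casimirs π) (MultiVF n) where
  carrier := {P | P ∈ homog n k ∧ schouten π P = 0}
  add_mem' hP hQ := ⟨add_mem hP.1 hQ.1, by rw [schouten_add, hP.2, hQ.2, add_zero]⟩
  zero_mem' := ⟨zero_mem _, by
    have := schouten_casimir_smul π 0 0
    rwa [smul_zero, zero_smul] at this⟩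
  smul_mem' f P hP := ⟨(homog n k).smul_mem (f : Smooth n) hP.1, by
    rw [schouten_casimir_smul, hP.2, smul_zero]⟩

/-- `k`-coboundaries of the Poisson complex: the image of `d_π` on `𝔛^{k-1}(ℝⁿ)`, which is `0`
for `k = 0`. -/
def coboundaries {n : ℕ} (π : MultiVF n) (k : ℕ) : Submodule (casimirs π) (MultiVF n) where
  carrier := {P | P = 0 ∨ ∃ j, j + 1 = k ∧ ∃ Q ∈ homog n j, schouten π Q = P}
  add_mem' := by
    rintro P Q (rfl | ⟨j, hj, P', hP, rfl⟩) (rfl | ⟨l, hl, Q', hQ, rfl⟩)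
    · simp
    · exact Or.inr ⟨l, hl, Q', hQ, by simp⟩
    · exact Or.inr ⟨j, hj, P', hP, by simp⟩
    · obtain rfl : j = l := by omega
      exact Or.inr ⟨j, hj, P' + Q', add_mem hP hQ, schouten_add _ _ _⟩
  zero_mem' := Or.inl rfl
  smul_mem' := by
    rintro f P (rfl | ⟨j, hj, P', hP, rfl⟩)
    · simp
    · exact Or.inr ⟨j, hj, f • P', (homog n j).smul_mem (f : Smooth n) hP,
        schouten_casimir_smul _ _ _⟩

/-- The Poisson cohomology `H^k(ℝⁿ, π)`, a module over the Casimirs. -/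
abbrev H {n : ℕ} (π : MultiVF n) (k : ℕ) : Type :=
  cocycles π k ⧸ (coboundaries π k).comap (cocycles π k).subtype

/-- `P` is a `k`-cocycle and its class is `c`. -/
def Represents {n : ℕ} {π : MultiVF n} {k : ℕ} (P : MultiVF n) (c : H π k) : Prop :=
  ∃ h : P ∈ cocycles π k, Submodule.Quotient.mk ⟨P, h⟩ = c

/-- `P` and `Q` are `k`-cocycles and `[P] = [Q]` in `H^k(ℝⁿ, π)`. -/
def SameClass {n : ℕ} (π : MultiVF n) (k : ℕ) (P Q : MultiVF n) : Prop :=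
  ∃ c : H π k, Represents P c ∧ Represents Q c

/-- Smooth functions on a subset `S` of a normed space (used for `[0, ∞)` and
`[0, ∞) × ℝ`, where derivatives at the boundary are one-sided).  The values of `g` outside `S`
do not matter. -/
def SmoothOn {F : Type} [NormedAddCommGroup F] [NormedSpace ℝ F] (S : Set F) : Type :=
  {f : S → ℝ // ∃ g : F → ℝ, ContDiffOn ℝ ∞ g S ∧ ∀ x : S, g x = f x}

/-- `C^∞([0, ∞))`. -/
abbrev SmoothHalfLine : Type := SmoothOn (Set.Ici (0 : ℝ))

/-- `C^∞([0, ∞) × ℝ)`. -/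
abbrev SmoothHalfPlane : Type := SmoothOn (Set.Ici (0 : ℝ) ×ˢ (Set.univ : Set ℝ))

/-- `C^∞(ℝ)`. -/
abbrev SmoothLine : Type := {g : ℝ → ℝ // ContDiff ℝ ∞ g}

/-- The coordinate function `xᵢ`. -/
def coord {n : ℕ} (i : Fin n) : Smooth n := ⟨fun p => p i, mem_smooth.2 (contDiff_apply ℝ ℝ i)⟩

/-- The function `f(x² + y²)` on `ℝ³`. -/
def radial (f : SmoothHalfLine) : Smooth 3 :=
  ⟨fun p => f.1 ⟨p 0 ^ 2 + p 1 ^ 2, by simp only [Set.mem_Ici]; positivity⟩, by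
    obtain ⟨g, hg, hgf⟩ := f.2
    have h : ContDiff ℝ ∞ (fun p : Fin 3 → ℝ => p 0 ^ 2 + p 1 ^ 2) := by fun_prop
    have := hg.comp_contDiff h fun p => by simp only [Set.mem_Ici]; positivity
    refine mem_smooth.2 ?_
    convert this using 1
    exact funext fun (p : Fin 3 → ℝ) => (hgf ⟨p 0 ^ 2 + p 1 ^ 2, _⟩).symm⟩

/-- The function `g(z)` on `ℝ³`. -/
def axial (g : SmoothLine) : Smooth 3 :=
  ⟨fun p => g.1 (p 2), mem_smooth.2 (g.2.comp (contDiff_apply ℝ ℝ 2))⟩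

/-- The function `h(x² + y², z)` on `ℝ³`. -/
def radialZ (h : SmoothHalfPlane) : Smooth 3 :=
  ⟨fun p => h.1 ⟨(p 0 ^ 2 + p 1 ^ 2, p 2), by
      simp only [Set.mem_prod, Set.mem_Ici, Set.mem_univ, and_true]; positivity⟩, by
    obtain ⟨g, hg, hgf⟩ := h.2
    have h : ContDiff ℝ ∞ (fun p : Fin 3 → ℝ => (p 0 ^ 2 + p 1 ^ 2, p 2)) := by fun_prop
    have := hg.comp_contDiff h fun p => by
      simp only [Set.mem_prod, Set.mem_Ici, Set.mem_univ, and_true]; positivity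
    refine mem_smooth.2 ?_
    convert this using 1
    exact funext fun (p : Fin 3 → ℝ) => (hgf ⟨(p 0 ^ 2 + p 1 ^ 2, p 2), _⟩).symm⟩

/-- The function `z ↦ h(0, z)`. -/
def onAxis (h : SmoothHalfPlane) : SmoothLine :=
  ⟨fun z => h.1 ⟨(0, z), by simp⟩, by
    obtain ⟨g, hg, hgf⟩ := h.2
    have h : ContDiff ℝ ∞ (fun z : ℝ => ((0 : ℝ), z)) := by fun_prop
    have := hg.comp_contDiff h fun p => by simp
    convert this using 1
    exact funext fun p => (hgf ⟨(0, p), _⟩).symm⟩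

/-- `E = x ∂_x + y ∂_y`. -/
def vfE : MultiVF 3 := (coord 0 : Smooth 3) • dd {0} + (coord 1 : Smooth 3) • dd {1}

/-- `T = -y ∂_x + x ∂_y`. -/
def vfT : MultiVF 3 := -((coord 1 : Smooth 3) • dd {0}) + (coord 0 : Smooth 3) • dd {1}

/-- `∂_z`. -/
def vfZ : MultiVF 3 := dd {2}

/-- `∂_x ∧ ∂_y`. -/
def dxy : MultiVF 3 := wedge (dd {0}) (dd {1})

/-- `∂_x ∧ ∂_y ∧ ∂_z`. -/
def dxyz : MultiVF 3 := wedge dxy vfZ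

/-- The Poisson structure `π = T ∧ ∂_z` on `ℝ³ = 𝔢(2)^*`. -/
def piE2 : MultiVF 3 := wedge vfT vfZ

/-- `E(f) = x ∂f/∂x + y ∂f/∂y`. -/
def eulerD (f : Smooth 3) : Smooth 3 := coord 0 * pd 0 f + coord 1 * pd 1 f

/-- The vector field `a E + b ∂_z`. -/
def vec (a b : Smooth 3) : MultiVF 3 := a • vfE + b • vfZ

/-- The bivector field `c E ∧ ∂_z + k ∂_x ∧ ∂_y`. -/
def biv (c k : Smooth 3) : MultiVF 3 := c • wedge vfE vfZ + k • dxy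

/-- The trivector field `k ∂_x ∧ ∂_y ∧ ∂_z`. -/
def tri (k : Smooth 3) : MultiVF 3 := k • dxyz

/-- The value of `f` at the origin. -/
def atZero (f : Smooth 3) : ℝ := f.1 0

end PoissonCoh

end

/-! The differential is explicit: `d_π f = (∂_z f) T - T(f) ∂_z`, and `schouten_piE2_mvf` gives it
in every degree in terms of `∂_z`, `T` and multiplication by `x` and `y`. Three tools compute its
cohomology.

In the `z`-direction every function has an antiderivative that commutes with `T` (`antiD`), so
dependence on `z` can be removed by coboundaries. Along the circles, averaging splits a function or
a planar vector field into an invariant part and a Lie derivative along `T` (`exists_average`,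
`exists_average_vector`), while an invariant function of the form `T f` vanishes (`eq_zero_of_tD`).
On the axis, where `T` degenerates, division by `x` and `y` rests on Hadamard's lemma and on
exactness of the Koszul complex (`exists_eq_of_axis`, `exists_of_coord_mul_eq`).

What survives is an invariant planar field, which equals `aE + cT` (`exists_of_invariant_vector`).
Its part `cT` is `d_π(zc)`, and likewise `cT ∧ ∂_z = d_π(zc ∂_z)`. The coefficient `a` is detected
by pairing with `E`, which has square length `ρ = x² + y²`. In degrees 2 and 3 a function of `z`
survives as well, because the relevant component of a coboundary vanishes on the axis. Casimirs are
invariant and independent of `z`; Whitney's theorem (`contDiffOn_sqrt_val`) makes them smooth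
functions of `ρ` up to the boundary.

For the products and brackets, both sides are expanded in components and differ by an explicit
coboundary. The main source is that an invariant function vanishing on the axis is `ρ` times an
invariant function (`exists_eq_rho_mul`). -/

noncomputable section

namespace PoissonCoh

/-! ### Smoothness of integrals depending on a parameter. -/

section parametric

open MeasureTheory

variable {H : Type} [NormedAddCommGroup H] [NormedSpace ℝ H] [ProperSpace H]

/-- Differentiation under the integral sign for jointly `C¹` integrands. -/
lemma hasFDerivAt_integral_of_contDiff {E : Type} [NormedAddCommGroup E] [NormedSpace ℝ E]
    {F : H → ℝ → E} (hF : ContDiff ℝ 1 fun q : H × ℝ => F q.1 q.2) (a b : ℝ) (x : H) :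
    HasFDerivAt (fun x => ∫ t in a..b, F x t)
      (∫ t in a..b, fderiv ℝ (fun y => F y t) x) x := by
  have hd : ∀ x t, HasFDerivAt (fun y => F y t)
      ((fderiv ℝ (fun q : H × ℝ => F q.1 q.2) (x, t)).comp (.inl ℝ H ℝ)) x := fun x t => by
    have h1 := (hF.differentiable (by simp) (x, t)).hasFDerivAt
    exact HasFDerivAt.comp (g := fun q : H × ℝ => F q.1 q.2) (f := fun y : H => (y, t)) x h1
      (hasFDerivAt_prodMk_left x t)
  have hc : Continuous fun q : H × ℝ => fderiv ℝ (fun y => F y q.2) q.1 := by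
    simp only [fun x t => (hd x t).fderiv]
    exact (hF.continuous_fderiv (by simp)).clm_comp_const _
  have hFc : ∀ x, Continuous (F x) := fun x => hF.continuous.comp (Continuous.prodMk_right x)
  obtain ⟨C, hC⟩ := ((isCompact_closedBall x 1).prod
    (isCompact_uIcc (a := a) (b := b))).exists_bound_of_continuousOn hc.continuousOn
  refine intervalIntegral.hasFDerivAt_integral_of_dominated_of_fderiv_le (bound := fun _ => C)
    (F' := fun x t => fderiv ℝ (fun y => F y t) x)
    (Metric.closedBall_mem_nhds x one_pos) (.of_forall fun y => (hFc y).aestronglyMeasurable)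
    ((hFc x).intervalIntegrable _ _)
    (hc.comp (Continuous.prodMk_right x)).aestronglyMeasurable
    (.of_forall fun t ht y hy => hC (y, t) ⟨hy, Set.uIoc_subset_uIcc ht⟩)
    intervalIntegrable_const (.of_forall fun t _ y _ => (hd y t).differentiableAt.hasFDerivAt)

/-- The derivative is again a parametric integral, but with values in `H →L[ℝ] E`. This is why `E`
is quantified inside the induction. -/
lemma contDiff_integral_nat (n : ℕ) : ∀ {E : Type} [NormedAddCommGroup E] [NormedSpace ℝ E]
    {F : H → ℝ → E}, ContDiff ℝ ∞ (fun q : H × ℝ => F q.1 q.2) → ∀ a b : ℝ,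
    ContDiff ℝ n fun x => ∫ t in a..b, F x t := by
  induction n with
  | zero =>
    intro E _ _ F hF a b
    have h1 : ContDiff ℝ 1 fun q : H × ℝ => F q.1 q.2 := hF.of_le (by simp)
    exact contDiff_zero.2 (continuous_iff_continuousAt.2 fun x =>
      (hasFDerivAt_integral_of_contDiff h1 a b x).continuousAt)
  | succ n ih =>
    intro E _ _ F hF a b
    have h1 : ContDiff ℝ 1 fun q : H × ℝ => F q.1 q.2 := hF.of_le (by simp)
    refine contDiff_succ_iff_hasFDerivAt.2
      ⟨fun x => ∫ t in a..b, fderiv ℝ (fun y => F y t) x, ?_,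
        hasFDerivAt_integral_of_contDiff h1 a b⟩
    refine ih (F := fun x t => fderiv ℝ (fun y => F y t) x) ?_ a b
    exact ContDiff.fderiv (f := fun (q : H × ℝ) (y : H) => F y q.2) (n := ∞)
      (hF.comp (contDiff_snd.prodMk contDiff_fst.snd)) contDiff_fst (by simp)

/-- A parametric integral of a smooth function is smooth. -/
lemma contDiff_integral {E : Type} [NormedAddCommGroup E] [NormedSpace ℝ E]
    {F : H → ℝ → E} (hF : ContDiff ℝ ∞ fun q : H × ℝ => F q.1 q.2) (a b : ℝ) :
    ContDiff ℝ ∞ fun x => ∫ t in a..b, F x t :=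
  contDiff_infty.2 fun n => contDiff_integral_nat n hF a b

end parametric

/-! ### Values and partial derivatives of smooth functions. -/

section values

variable {n : ℕ}

@[simp] lemma val_add (f g : Smooth n) (p : Fin n → ℝ) : (f + g).1 p = f.1 p + g.1 p := rfl

@[simp] lemma val_sub (f g : Smooth n) (p : Fin n → ℝ) : (f - g).1 p = f.1 p - g.1 p := rfl

@[simp] lemma val_neg (f : Smooth n) (p : Fin n → ℝ) : (-f).1 p = -f.1 p := rfl

@[simp] lemma val_mul (f g : Smooth n) (p : Fin n → ℝ) : (f * g).1 p = f.1 p * g.1 p := rfl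

@[simp] lemma val_zero (p : Fin n → ℝ) : (0 : Smooth n).1 p = 0 := rfl

@[simp] lemma val_one (p : Fin n → ℝ) : (1 : Smooth n).1 p = 1 := rfl

@[simp] lemma val_smul (c : ℝ) (f : Smooth n) (p : Fin n → ℝ) : (c • f).1 p = c * f.1 p := rfl

@[simp] lemma val_coord (i : Fin n) (p : Fin n → ℝ) : (coord i).1 p = p i := rfl

lemma continuous_val (f : Smooth n) : Continuous f.1 := (smooth_contDiff f).continuous

lemma pd_val (i : Fin n) (f : Smooth n) (p : Fin n → ℝ) :
    (pd i f).1 p = fderiv ℝ f.1 p (Pi.single i 1) := rfl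

lemma fderiv_val (f : Smooth n) (p v : Fin n → ℝ) :
    fderiv ℝ f.1 p v = ∑ i, v i * (pd i f).1 p := by
  have hv : v = ∑ i, v i • Pi.single i (1 : ℝ) := by ext j; simp [Pi.single_apply]
  conv_lhs => rw [hv]
  simp only [map_sum, map_smul, smul_eq_mul, pd_val]

lemma hasDerivAt_val_comp (f : Smooth n) {γ : ℝ → Fin n → ℝ} {γ' : Fin n → ℝ} {t : ℝ}
    (h : HasDerivAt γ γ' t) :
    HasDerivAt (fun t => f.1 (γ t)) (fderiv ℝ f.1 (γ t) γ') t :=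
  (smooth_differentiableAt f (γ t)).hasFDerivAt.comp_hasDerivAt t h

/-- Partial derivatives commute. -/
lemma pd_comm (i j : Fin n) (f : Smooth n) : pd i (pd j f) = pd j (pd i f) := by
  have key : ∀ (i j : Fin n) p, (pd i (pd j f)).1 p =
      fderiv ℝ (fderiv ℝ f.1) p (Pi.single i 1) (Pi.single j 1) := fun i j p => by
    have hd : DifferentiableAt ℝ (fderiv ℝ f.1) p :=
      ((smooth_contDiff f).fderiv_right (m := ∞) (by simp)).differentiable (by simp) p
    have : HasFDerivAt (pd j f).1 _ p := hd.hasFDerivAt.clm_apply (hasFDerivAt_const (Pi.single j 1) p)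
    rw [pd_val, this.fderiv]
    simp
  refine Smooth.ext fun p => ?_
  rw [key, key]
  exact ((smooth_contDiff f).contDiffAt.isSymmSndFDerivAt
    (by simp only [minSmoothness_of_isRCLikeNormedField]; exact ENat.LEInfty.out)).eq _ _

lemma pd_coord (i j : Fin n) : pd i (coord j) = if i = j then 1 else 0 := by
  refine Smooth.ext fun p => ?_
  have : HasFDerivAt (coord j : Smooth n).1 (ContinuousLinearMap.proj j) p :=
    (ContinuousLinearMap.proj (R := ℝ) (φ := fun _ : Fin n => ℝ) j).hasFDerivAt
  rw [pd_val, this.fderiv]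
  by_cases h : i = j
  · subst h; simp
  · simp [h, Ne.symm h]

/-- Smooth functions which agree where `q` does not vanish are equal, if that set is dense. -/
lemma mul_left_cancel_of_dense {q : Smooth n} (hq : Dense {p | q.1 p ≠ 0}) {f g : Smooth n}
    (h : q * f = q * g) : f = g := by
  refine Subtype.ext ((continuous_val f).ext_on hq (continuous_val g) fun p hp => ?_)
  have := congrArg (fun s : Smooth n => s.1 p) h
  exact mul_left_cancel₀ hp this

lemma dense_coord_ne (i : Fin n) : Dense {p : Fin n → ℝ | (coord i : Smooth n).1 p ≠ 0} := by
  have : {p : Fin n → ℝ | (coord i : Smooth n).1 p ≠ 0} = (fun p => p i) ⁻¹' {0}ᶜ := rfl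
  rw [this]
  exact (dense_compl_singleton (0 : ℝ)).preimage (isOpenMap_eval i)

lemma coord_mul_cancel {i : Fin n} {f g : Smooth n} (h : coord i * f = coord i * g) : f = g :=
  mul_left_cancel_of_dense (dense_coord_ne i) h

end values

/-! ### Weighted integrals over families of linear maps. -/

section weighted

variable {n : ℕ} (a b : ℝ) (φ : SmoothLine) {L : ℝ → (Fin n → ℝ) →L[ℝ] (Fin n → ℝ)}
  (hL : ContDiff ℝ ∞ L) (f : Smooth n)

lemma weighted_contDiff {L : ℝ → (Fin n → ℝ) →L[ℝ] (Fin n → ℝ)} (hL : ContDiff ℝ ∞ L) :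
    ContDiff ℝ ∞ fun q : (Fin n → ℝ) × ℝ => φ.1 q.2 * f.1 (L q.2 q.1) :=
  (φ.2.comp contDiff_snd).mul
    ((smooth_contDiff f).comp ((hL.comp contDiff_snd).clm_apply contDiff_fst))

/-- The function `p ↦ ∫ₐᵇ φ(t) f(L_t p) dt` for a smooth family `L` of linear maps. -/
def weightedInt : Smooth n :=
  ⟨fun p => ∫ t in a..b, φ.1 t * f.1 (L t p),
    mem_smooth.2 (contDiff_integral (F := fun p t => φ.1 t * f.1 (L t p))
      (weighted_contDiff φ f hL) a b)⟩

lemma weightedInt_val (p : Fin n → ℝ) :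
    (weightedInt a b φ hL f).1 p = ∫ t in a..b, φ.1 t * f.1 (L t p) := rfl

lemma fderiv_weightedInt (p v : Fin n → ℝ) :
    fderiv ℝ (weightedInt a b φ hL f).1 p v =
      ∫ t in a..b, φ.1 t * fderiv ℝ f.1 (L t p) (L t v) := by
  have h1 := (weighted_contDiff φ f hL).of_le (m := 1) (by simp)
  have hd : ∀ t, HasFDerivAt (fun y => φ.1 t * f.1 (L t y))
      (φ.1 t • (fderiv ℝ f.1 (L t p)).comp (L t)) p := fun t =>
    (((smooth_differentiableAt f (L t p)).hasFDerivAt.comp p (L t).hasFDerivAt).const_mul _)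
  have h2 := (hasFDerivAt_integral_of_contDiff (F := fun p t => φ.1 t * f.1 (L t p)) h1 a b p)
  have hc : Continuous fun t => φ.1 t • (fderiv ℝ f.1 (L t p)).comp (L t) := by
    have h3 : Continuous fun t => fderiv ℝ f.1 (L t p) :=
      ((smooth_contDiff f).continuous_fderiv (by simp)).comp
        (hL.continuous.clm_apply continuous_const)
    exact φ.2.continuous.smul (h3.clm_comp hL.continuous)
  simp only [fun t => (hd t).fderiv] at h2
  change fderiv ℝ (fun p => ∫ t in a..b, φ.1 t * f.1 (L t p)) p v = _
  rw [h2.fderiv, ContinuousLinearMap.intervalIntegral_apply (hc.intervalIntegrable _ _)]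
  rfl

lemma continuous_weighted {L : ℝ → (Fin n → ℝ) →L[ℝ] (Fin n → ℝ)} (hL : ContDiff ℝ ∞ L)
    (p : Fin n → ℝ) : Continuous fun t => φ.1 t * f.1 (L t p) :=
  φ.2.continuous.mul ((continuous_val f).comp (hL.continuous.clm_apply continuous_const))

lemma weightedInt_add (f g : Smooth n) :
    weightedInt a b φ hL (f + g) = weightedInt a b φ hL f + weightedInt a b φ hL g := by
  refine Smooth.ext fun p => ?_
  simp only [weightedInt_val, val_add, mul_add]
  exact intervalIntegral.integral_add ((continuous_weighted φ f hL p).intervalIntegrable _ _)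
    ((continuous_weighted φ g hL p).intervalIntegrable _ _)

end weighted

/-! ### Dilations: Hadamard's lemma, antiderivatives and Koszul exactness. -/

section dilations

variable {n : ℕ}

/-- Multiplication of the coordinates in `s` by `t`. -/
def dil (s : Finset (Fin n)) (t : ℝ) : (Fin n → ℝ) →L[ℝ] (Fin n → ℝ) :=
  ContinuousLinearMap.pi fun i => (if i ∈ s then t else 1) • ContinuousLinearMap.proj i

@[simp] lemma dil_apply (s : Finset (Fin n)) (t : ℝ) (p : Fin n → ℝ) (i : Fin n) :
    dil s t p i = if i ∈ s then t * p i else p i := by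
  by_cases h : i ∈ s <;> simp [dil, h]

lemma dil_one (s : Finset (Fin n)) (p : Fin n → ℝ) : dil s 1 p = p := by
  ext i; simp

lemma dil_single (s : Finset (Fin n)) (t : ℝ) (i : Fin n) :
    dil s t (Pi.single i 1) = (if i ∈ s then t else 1) • Pi.single i 1 := by
  ext j
  rcases eq_or_ne i j with rfl | h
  · by_cases h : i ∈ s <;> simp [h]
  · simp [h.symm]

lemma contDiff_dil (s : Finset (Fin n)) : ContDiff ℝ ∞ (dil s) := by
  refine contDiff_clm_apply_iff.2 fun p => contDiff_pi.2 fun i => ?_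
  by_cases h : i ∈ s
  · simpa [h] using contDiff_id.mul contDiff_const
  · simpa [h] using contDiff_const

lemma hasDerivAt_dil (s : Finset (Fin n)) (t : ℝ) (p : Fin n → ℝ) :
    HasDerivAt (fun t => dil s t p) (fun i => if i ∈ s then p i else 0) t := by
  refine hasDerivAt_pi.2 fun i => ?_
  by_cases h : i ∈ s
  · simpa [h] using (hasDerivAt_id t).mul_const (p i)
  · simpa [h] using hasDerivAt_const t (p i)

/-- The monomial `t ^ m`. -/
def mono (m : ℕ) : SmoothLine := ⟨fun t => t ^ m, contDiff_id.pow m⟩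

/-- The function `p ↦ ∫₀¹ t ^ m f(δ_t p) dt`, where `δ_t` multiplies the coordinates in `s`
by `t`. -/
def dilInt (s : Finset (Fin n)) (m : ℕ) (f : Smooth n) : Smooth n :=
  weightedInt 0 1 (mono m) (contDiff_dil s) f

lemma dilInt_val (s : Finset (Fin n)) (m : ℕ) (f : Smooth n) (p : Fin n → ℝ) :
    (dilInt s m f).1 p = ∫ t in (0 : ℝ)..1, t ^ m * f.1 (dil s t p) := rfl

lemma dilInt_add (s : Finset (Fin n)) (m : ℕ) (f g : Smooth n) :
    dilInt s m (f + g) = dilInt s m f + dilInt s m g := weightedInt_add _ _ _ _ f g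

/-- The chain rule produces a factor `t` for each derivative in a dilated direction, as does each
factor `xᵢ` below. The weights `t ^ m` keep track of these factors. -/
lemma pd_dilInt_of_mem {s : Finset (Fin n)} {i : Fin n} (hi : i ∈ s) (m : ℕ) (f : Smooth n) :
    pd i (dilInt s m f) = dilInt s (m + 1) (pd i f) := by
  refine Smooth.ext fun p => ?_
  rw [pd_val, dilInt, fderiv_weightedInt, dilInt_val]
  refine intervalIntegral.integral_congr fun t _ => ?_
  simp [dil_single, hi, mono, pd_val, pow_succ, mul_assoc]

lemma pd_dilInt_of_notMem {s : Finset (Fin n)} {i : Fin n} (hi : i ∉ s) (m : ℕ)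
    (f : Smooth n) : pd i (dilInt s m f) = dilInt s m (pd i f) := by
  refine Smooth.ext fun p => ?_
  rw [pd_val, dilInt, fderiv_weightedInt, dilInt_val]
  refine intervalIntegral.integral_congr fun t _ => ?_
  simp [dil_single, hi, mono, pd_val]

lemma dilInt_coord_mul_of_mem {s : Finset (Fin n)} {i : Fin n} (hi : i ∈ s) (m : ℕ)
    (f : Smooth n) : dilInt s m (coord i * f) = coord i * dilInt s (m + 1) f := by
  refine Smooth.ext fun p => ?_
  rw [val_mul, dilInt_val, dilInt_val, ← intervalIntegral.integral_const_mul]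
  refine intervalIntegral.integral_congr fun t _ => ?_
  simp only [val_mul, val_coord, dil_apply, hi, if_true]; ring

lemma dilInt_coord_mul_of_notMem {s : Finset (Fin n)} {i : Fin n} (hi : i ∉ s) (m : ℕ)
    (f : Smooth n) : dilInt s m (coord i * f) = coord i * dilInt s m f := by
  refine Smooth.ext fun p => ?_
  rw [val_mul, dilInt_val, dilInt_val, ← intervalIntegral.integral_const_mul]
  refine intervalIntegral.integral_congr fun t _ => ?_
  simp only [val_mul, val_coord, dil_apply, hi, if_false]; ring

lemma continuous_fderiv_dil (s : Finset (Fin n)) (f : Smooth n) (p v : Fin n → ℝ) :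
    Continuous fun t => fderiv ℝ f.1 (dil s t p) v :=
  (((smooth_contDiff f).continuous_fderiv (by simp)).comp
    ((contDiff_dil s).continuous.clm_apply continuous_const)).clm_apply continuous_const

/-- Hadamard's lemma: `f - f(δ₀ ·) = ∑_{i ∈ s} xᵢ ∫₀¹ (∂ᵢ f)(δ_t ·) dt`. -/
lemma hadamard (s : Finset (Fin n)) (f : Smooth n) (p : Fin n → ℝ) :
    f.1 p - f.1 (dil s 0 p) = ∑ i ∈ s, p i * (dilInt s 0 (pd i f)).1 p := by
  have h := intervalIntegral.integral_eq_sub_of_hasDerivAt (a := 0) (b := 1)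
    (fun t _ => hasDerivAt_val_comp f (hasDerivAt_dil s t p))
    ((continuous_fderiv_dil s f p _).intervalIntegrable _ _)
  rw [dil_one] at h
  rw [← h]
  simp only [fderiv_val, ite_mul, zero_mul, Finset.sum_ite_mem, Finset.univ_inter]
  rw [intervalIntegral.integral_finsetSum]
  · refine Finset.sum_congr rfl fun i _ => ?_
    rw [intervalIntegral.integral_const_mul, dilInt_val]; simp
  · intro i _
    refine Continuous.intervalIntegrable ?_ _ _
    exact continuous_const.mul (continuous_fderiv_dil s f p (Pi.single i 1))

/-- Integrating `d/dt (t f(δ_t p))` over `[0, 1]`, for dilations of one coordinate. -/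
lemma dilInt_add_coord_mul (i : Fin n) (f : Smooth n) :
    dilInt {i} 0 f + coord i * dilInt {i} 1 (pd i f) = f := by
  refine Smooth.ext fun p => ?_
  have hc := (continuous_val f).comp
    ((contDiff_dil {i}).continuous.clm_apply (continuous_const (y := p)))
  have hc' : Continuous fun t => (pd i f).1 (dil {i} t p) :=
    continuous_fderiv_dil {i} f p (Pi.single i 1)
  have h := intervalIntegral.integral_eq_sub_of_hasDerivAt (a := 0) (b := 1)
    (f := fun t => t * f.1 (dil {i} t p))
    (f' := fun t => t ^ 0 * f.1 (dil {i} t p) + p i * (t ^ 1 * (pd i f).1 (dil {i} t p)))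
    (fun t _ => by
      refine ((hasDerivAt_id t).mul (hasDerivAt_val_comp f (hasDerivAt_dil {i} t p))).congr_deriv ?_
      simp [fderiv_val]; ring)
    (Continuous.intervalIntegrable ((continuous_const.mul hc).add
      (continuous_const.mul ((continuous_id.pow 1).mul hc'))) _ _)
  rw [intervalIntegral.integral_add, intervalIntegral.integral_const_mul] at h
  · rw [val_add, val_mul, val_coord, dilInt_val, dilInt_val, h, dil_one]; simp
  · exact Continuous.intervalIntegrable ((continuous_id.pow 0).mul hc) _ _
  · exact Continuous.intervalIntegrable (continuous_const.mul ((continuous_id.pow 1).mul hc')) _ _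

/-- An antiderivative with respect to `xᵢ`. -/
def antiD (i : Fin n) (f : Smooth n) : Smooth n := coord i * dilInt {i} 0 f

lemma pd_antiD (i : Fin n) (f : Smooth n) : pd i (antiD i f) = f := by
  rw [antiD, Derivation.leibniz, pd_dilInt_of_mem (by simp), pd_coord, if_pos rfl, smul_eq_mul,
    smul_eq_mul, mul_one, add_comm]
  exact dilInt_add_coord_mul i f

lemma pd_antiD_of_ne {i j : Fin n} (h : j ≠ i) (f : Smooth n) :
    pd j (antiD i f) = antiD i (pd j f) := by
  rw [antiD, Derivation.leibniz, pd_dilInt_of_notMem (by simpa using h), pd_coord, if_neg h]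
  simp [antiD]

lemma antiD_coord_mul {i j : Fin n} (h : j ≠ i) (f : Smooth n) :
    antiD i (coord j * f) = coord j * antiD i f := by
  rw [antiD, dilInt_coord_mul_of_notMem (by simpa using h), antiD]; ring

lemma antiD_add (i : Fin n) (f g : Smooth n) : antiD i (f + g) = antiD i f + antiD i g := by
  rw [antiD, dilInt_add, mul_add]; rfl

/-- Exactness of the Koszul complex of two coordinates. -/
lemma exists_of_coord_mul_eq {i j : Fin n} (hij : i ≠ j) {f g : Smooth n}
    (h : coord j * f = coord i * g) : ∃ k, f = coord i * k ∧ g = coord j * k := by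
  have hf : f = coord i * dilInt {i} 0 (pd i f) := by
    -- The relation only shows that `xⱼ f` vanishes where `xᵢ = 0`, so the factor `xⱼ` is carried
    -- through Hadamard's formula and cancelled by density.
    refine coord_mul_cancel (i := j) (Smooth.ext fun p => ?_)
    have h1 := hadamard {i} f p
    have h2 := congrArg (fun s : Smooth n => s.1 (dil {i} 0 p)) h
    simp only [val_mul, val_coord, dil_apply, Finset.mem_singleton, hij.symm, if_false,
      if_true, zero_mul] at h2
    rw [Finset.sum_singleton] at h1
    rw [val_mul, val_mul, val_mul, val_coord, val_coord, ← h1, mul_sub, h2, sub_zero]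
  exact ⟨_, hf, coord_mul_cancel (i := i) (by rw [← h, mul_left_comm, ← hf])⟩

end dilations

/-! ### Rotations about the axis and averaging over circles. -/

section rotations

lemma pd_smul {n : ℕ} (i : Fin n) (c : ℝ) (f : Smooth n) : pd i (c • f) = c • pd i f :=
  Derivation.map_smul (pd i) c f

/-- The action of the rotation field `T = -y ∂_x + x ∂_y` on functions. -/
def tD (f : Smooth 3) : Smooth 3 := coord 0 * pd 1 f - coord 1 * pd 0 f

/-- Rotation by the angle `θ` about the `z`-axis. -/
def rot (θ : ℝ) : (Fin 3 → ℝ) →L[ℝ] (Fin 3 → ℝ) :=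
  ContinuousLinearMap.pi ![Real.cos θ • ContinuousLinearMap.proj 0 -
      Real.sin θ • ContinuousLinearMap.proj 1,
    Real.sin θ • ContinuousLinearMap.proj 0 + Real.cos θ • ContinuousLinearMap.proj 1,
    ContinuousLinearMap.proj 2]

lemma rot_apply (θ : ℝ) (p : Fin 3 → ℝ) : rot θ p =
    ![Real.cos θ * p 0 - Real.sin θ * p 1, Real.sin θ * p 0 + Real.cos θ * p 1, p 2] := by
  ext i; fin_cases i <;> simp [rot]

lemma contDiff_rot : ContDiff ℝ ∞ rot := by
  refine contDiff_clm_apply_iff.2 fun p => contDiff_pi.2 fun i => ?_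
  simp only [rot_apply]
  fin_cases i
  · exact (Real.contDiff_cos.mul contDiff_const).sub (Real.contDiff_sin.mul contDiff_const)
  · exact (Real.contDiff_sin.mul contDiff_const).add (Real.contDiff_cos.mul contDiff_const)
  · exact contDiff_const

lemma rot_zero (p : Fin 3 → ℝ) : rot 0 p = p := by
  rw [rot_apply]; ext i; fin_cases i <;> simp

lemma rot_two_pi (p : Fin 3 → ℝ) : rot (2 * Real.pi) p = p := by
  rw [rot_apply]; ext i; fin_cases i <;> simp

lemma hasDerivAt_rot (θ : ℝ) (p : Fin 3 → ℝ) :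
    HasDerivAt (fun θ => rot θ p) (rot θ ![-p 1, p 0, 0]) θ := by
  simp only [rot_apply]
  refine hasDerivAt_pi.2 fun i => ?_
  fin_cases i
  · refine (((Real.hasDerivAt_cos θ).mul_const (p 0)).sub
      ((Real.hasDerivAt_sin θ).mul_const (p 1))).congr_deriv ?_
    simp; ring
  · refine (((Real.hasDerivAt_sin θ).mul_const (p 0)).add
      ((Real.hasDerivAt_cos θ).mul_const (p 1))).congr_deriv ?_
    simp; ring
  · exact hasDerivAt_const θ (p 2)

lemma tD_val (f : Smooth 3) (p : Fin 3 → ℝ) :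
    (tD f).1 p = fderiv ℝ f.1 p ![-p 1, p 0, 0] := by
  rw [fderiv_val]
  simp [tD, Fin.sum_univ_three]; ring

lemma hasDerivAt_val_rot (f : Smooth 3) (θ : ℝ) (p : Fin 3 → ℝ) :
    HasDerivAt (fun θ => f.1 (rot θ p)) ((tD f).1 (rot θ p)) θ := by
  refine (hasDerivAt_val_comp f (hasDerivAt_rot θ p)).congr_deriv ?_
  rw [tD_val]
  congr 1
  simp only [rot_apply]
  ext i; fin_cases i <;> simp <;> ring

/-- `f` is constant along circles if `T f = 0`. -/
lemma val_rot_of_tD {f : Smooth 3} (h : tD f = 0) (θ : ℝ) (p : Fin 3 → ℝ) :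
    f.1 (rot θ p) = f.1 p := by
  have h1 : ∀ θ, HasDerivAt (fun θ => f.1 (rot θ p)) 0 θ := fun θ => by
    simpa [h] using hasDerivAt_val_rot f θ p
  have := is_const_of_deriv_eq_zero (fun θ => (h1 θ).differentiableAt) (fun θ => (h1 θ).deriv) θ 0
  rwa [rot_zero] at this

/-- Polar coordinates in the `(x, y)`-plane; on the axis the radius is zero and the value of
`Complex.arg` is immaterial. -/
lemma exists_rot (p : Fin 3 → ℝ) : ∃ θ, rot θ ![√(p 0 ^ 2 + p 1 ^ 2), 0, p 2] = p := by
  refine ⟨Complex.arg ⟨p 0, p 1⟩, ?_⟩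
  have h1 : √(p 0 ^ 2 + p 1 ^ 2) = ‖(⟨p 0, p 1⟩ : ℂ)‖ := by
    rw [Complex.norm_def, Complex.normSq_mk]; ring_nf
  rw [rot_apply, h1]
  ext i
  fin_cases i
  · simp [mul_comm]
  · simp [mul_comm]
  · rfl

lemma val_of_tD {f : Smooth 3} (h : tD f = 0) (p : Fin 3 → ℝ) :
    f.1 p = f.1 ![√(p 0 ^ 2 + p 1 ^ 2), 0, p 2] := by
  obtain ⟨θ, hθ⟩ := exists_rot p
  conv_lhs => rw [← hθ]
  exact val_rot_of_tD h _ _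

lemma tD_add (f g : Smooth 3) : tD (f + g) = tD f + tD g := by
  simp only [tD, map_add]; ring

lemma tD_sub (f g : Smooth 3) : tD (f - g) = tD f - tD g := by
  simp only [tD, map_sub]; ring

lemma tD_neg (f : Smooth 3) : tD (-f) = -tD f := by
  simp only [tD, map_neg]; ring

lemma tD_zero : tD 0 = 0 := by simp [tD]

lemma tD_smul (c : ℝ) (f : Smooth 3) : tD (c • f) = c • tD f := by
  simp only [tD, pd_smul, mul_smul_comm, smul_sub]

lemma tD_mul (f g : Smooth 3) : tD (f * g) = f * tD g + g * tD f := by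
  simp only [tD, Derivation.leibniz, smul_eq_mul]; ring

lemma pd_two_tD (f : Smooth 3) : pd 2 (tD f) = tD (pd 2 f) := by
  simp only [tD, map_sub, Derivation.leibniz, smul_eq_mul, pd_coord]
  rw [pd_comm 2 1, pd_comm 2 0]
  simp

lemma tD_coord_zero : tD (coord 0) = -coord 1 := by simp [tD, pd_coord]

lemma tD_coord_one : tD (coord 1) = coord 0 := by simp [tD, pd_coord]

/-- If `T f` is a function which `T` kills, then it is zero. -/
lemma eq_zero_of_tD {f g : Smooth 3} (hg : tD g = 0) (h : tD f = g) : g = 0 := by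
  refine Smooth.ext fun p => ?_
  -- Along a circle `f` has the constant derivative `g(p)` and returns to its initial value, so `2π
  -- g(p) = 0`.
  have h1 := intervalIntegral.integral_eq_sub_of_hasDerivAt (a := 0) (b := 2 * Real.pi)
    (f' := fun _ => g.1 p)
    (fun θ _ => (hasDerivAt_val_rot f θ p).congr_deriv (by rw [h, val_rot_of_tD hg]))
    (continuous_const.intervalIntegrable _ _)
  rw [rot_two_pi, rot_zero, sub_self, intervalIntegral.integral_const, sub_zero, smul_eq_mul] at h1
  exact (mul_eq_zero.1 h1).resolve_left Real.two_pi_pos.ne'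

/-- The function `p ↦ ∫₀^{2π} b(θ) f(R_θ p) dθ`. -/
def rotInt (b : SmoothLine) (f : Smooth 3) : Smooth 3 :=
  weightedInt 0 (2 * Real.pi) b contDiff_rot f

lemma rotInt_val (b : SmoothLine) (f : Smooth 3) (p : Fin 3 → ℝ) :
    (rotInt b f).1 p = ∫ θ in (0 : ℝ)..2 * Real.pi, b.1 θ * f.1 (rot θ p) := rfl

lemma pd_two_rotInt (b : SmoothLine) (f : Smooth 3) :
    pd 2 (rotInt b f) = rotInt b (pd 2 f) := by
  refine Smooth.ext fun p => ?_
  rw [pd_val, rotInt, fderiv_weightedInt, rotInt_val]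
  refine intervalIntegral.integral_congr fun θ _ => ?_
  have : rot θ (Pi.single 2 1) = Pi.single 2 1 := by
    rw [rot_apply]; ext i; fin_cases i <;> simp
  simp only [this, pd_val]

/-- Integration by parts in `θ`: `T` acts on `f(R_θ p)` as `d/dθ`, and both boundary values of `f`
equal `f(p)` by periodicity. A periodic weight leaves no boundary term, while a weight with an extra
factor `θ` reproduces `f`. -/
lemma tD_rotInt {b b' : SmoothLine} (hb : ∀ θ, HasDerivAt b.1 (b'.1 θ) θ) (f : Smooth 3) :
    tD (rotInt b f) = (b.1 (2 * Real.pi) - b.1 0) • f - rotInt b' f := by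
  refine Smooth.ext fun p => ?_
  have hc : Continuous fun θ => (tD f).1 (rot θ p) :=
    (continuous_val _).comp (contDiff_rot.continuous.clm_apply continuous_const)
  have h := intervalIntegral.integral_mul_deriv_eq_deriv_mul (a := 0) (b := 2 * Real.pi)
    (fun θ _ => hb θ) (fun θ _ => hasDerivAt_val_rot f θ p)
    (b'.2.continuous.intervalIntegrable _ _) (hc.intervalIntegrable _ _)
  rw [rot_two_pi, rot_zero] at h
  rw [tD_val, rotInt, fderiv_weightedInt, val_sub, val_smul, sub_mul, rotInt_val, ← h]
  refine intervalIntegral.integral_congr fun θ _ => ?_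
  simp only [((hasDerivAt_val_comp f (hasDerivAt_rot θ p)).unique (hasDerivAt_val_rot f θ p))]

lemma rotInt_add_weight {b b₁ b₂ : SmoothLine} (h : ∀ θ, b.1 θ = b₁.1 θ + b₂.1 θ)
    (f : Smooth 3) : rotInt b f = rotInt b₁ f + rotInt b₂ f := by
  refine Smooth.ext fun p => ?_
  simp only [rotInt_val, val_add, h, add_mul]
  exact intervalIntegral.integral_add
    ((continuous_weighted _ f contDiff_rot p).intervalIntegrable _ _)
    ((continuous_weighted _ f contDiff_rot p).intervalIntegrable _ _)

lemma rotInt_sub_weight {b b₁ b₂ : SmoothLine} (h : ∀ θ, b.1 θ = b₁.1 θ - b₂.1 θ)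
    (f : Smooth 3) : rotInt b f = rotInt b₁ f - rotInt b₂ f := by
  rw [rotInt_add_weight (b := b₁) (b₁ := b) (b₂ := b₂) (fun θ => by rw [h]; ring)]; ring


/-- Averaging of functions over the rotations about the `z`-axis. -/
lemma exists_average (f : Smooth 3) (hf : pd 2 f = 0) :
    ∃ m u, tD m = 0 ∧ pd 2 m = 0 ∧ pd 2 u = 0 ∧ f = m + tD u := by
  let o : SmoothLine := ⟨fun _ => 0, contDiff_const⟩
  let i : SmoothLine := ⟨fun _ => 1, contDiff_const⟩
  let t : SmoothLine := ⟨fun θ => θ, contDiff_id⟩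
  have h0 : rotInt o f = 0 := Smooth.ext fun p => by simp [rotInt_val, o]
  have hz : ∀ b, rotInt b 0 = 0 := fun b => Smooth.ext fun p => by simp [rotInt_val]
  have h1 := tD_rotInt (b := i) (b' := o) (fun θ => hasDerivAt_const θ 1) f
  have h2 := tD_rotInt (b := t) (b' := i) (fun θ => hasDerivAt_id θ) f
  have hpi := Real.two_pi_pos.ne'
  -- Weight `1` gives the mean `m`; weight `θ` has boundary term `2π f`, hence gives `u` with `T u =
  -- f - m`.
  refine ⟨(2 * Real.pi)⁻¹ • rotInt i f, (2 * Real.pi)⁻¹ • rotInt t f, ?_, ?_, ?_, ?_⟩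
  · rw [tD_smul, h1, h0]; simp [i]
  · rw [pd_smul, pd_two_rotInt, hf, hz, smul_zero]
  · rw [pd_smul, pd_two_rotInt, hf, hz, smul_zero]
  · rw [tD_smul, h2, ← smul_add, add_sub_cancel, smul_smul]
    simp only [t, sub_zero, inv_mul_cancel₀ hpi, one_smul]

/-- Averaging of vector fields `f ∂_x + g ∂_y` over the rotations about the `z`-axis. -/
lemma exists_average_vector (f g : Smooth 3) (hf : pd 2 f = 0) (hg : pd 2 g = 0) :
    ∃ m n u v, tD m = -n ∧ tD n = m ∧ pd 2 m = 0 ∧ pd 2 n = 0 ∧ pd 2 u = 0 ∧ pd 2 v = 0 ∧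
      f = m + (tD u + v) ∧ g = n + (tD v - u) := by
  let c : SmoothLine := ⟨Real.cos, Real.contDiff_cos⟩
  let s : SmoothLine := ⟨Real.sin, Real.contDiff_sin⟩
  let c' : SmoothLine := ⟨fun θ => -Real.sin θ, Real.contDiff_sin.neg⟩
  let tc : SmoothLine := ⟨fun θ => θ * Real.cos θ, contDiff_id.mul Real.contDiff_cos⟩
  let ts : SmoothLine := ⟨fun θ => θ * Real.sin θ, contDiff_id.mul Real.contDiff_sin⟩
  let tc' : SmoothLine := ⟨fun θ => Real.cos θ - θ * Real.sin θ,
    Real.contDiff_cos.sub (contDiff_id.mul Real.contDiff_sin)⟩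
  let ts' : SmoothLine := ⟨fun θ => Real.sin θ + θ * Real.cos θ,
    Real.contDiff_sin.add (contDiff_id.mul Real.contDiff_cos)⟩
  have hz : ∀ b, rotInt b 0 = 0 := fun b => Smooth.ext fun p => by simp [rotInt_val]
  have hc' : ∀ f, rotInt c' f = -rotInt s f := fun f => Smooth.ext fun p => by
    simp [rotInt_val, c', s]
  have hc : ∀ f, tD (rotInt c f) = rotInt s f := fun f => by
    rw [tD_rotInt (b' := c') Real.hasDerivAt_cos, hc']; simp [c]
  have hs : ∀ f, tD (rotInt s f) = -rotInt c f := fun f => by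
    rw [tD_rotInt (b' := c) Real.hasDerivAt_sin]; simp [s]
  have htc : ∀ f, tD (rotInt tc f) = (2 * Real.pi) • f - rotInt c f + rotInt ts f := fun f => by
    rw [tD_rotInt (b' := tc') fun θ => ((hasDerivAt_id θ).mul (Real.hasDerivAt_cos θ)).congr_deriv
      (by simp [tc']; ring), rotInt_sub_weight (b := tc') (b₁ := c) (b₂ := ts) fun _ => rfl]
    simp [tc]; ring
  have hts : ∀ f, tD (rotInt ts f) = -rotInt s f - rotInt tc f := fun f => by
    rw [tD_rotInt (b' := ts') fun θ => ((hasDerivAt_id θ).mul (Real.hasDerivAt_sin θ)).congr_deriv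
      (by simp [ts']), rotInt_add_weight (b := ts') (b₁ := s) (b₂ := tc) fun _ => rfl]
    simp [ts]; ring
  have hpi := Real.two_pi_pos.ne'
  have key : ∀ f m w : Smooth 3, (2 * Real.pi) • f = m + w →
      f = (2 * Real.pi)⁻¹ • m + (2 * Real.pi)⁻¹ • w := fun f m w h => by
    rw [← smul_add, ← h, smul_smul, inv_mul_cancel₀ hpi, one_smul]
  -- The weights `cos` and `sin` rotate the vector `(f, g)` at `R_θ p` back by `-θ` before
  -- averaging; the extra factor `θ` gives the primitive. The pair `(Tu + v, Tv - u)` is the Lie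
  -- derivative of `u ∂_x + v ∂_y` along `T`.
  refine ⟨(2 * Real.pi)⁻¹ • (rotInt c f + rotInt s g), (2 * Real.pi)⁻¹ • (rotInt c g - rotInt s f),
    (2 * Real.pi)⁻¹ • (rotInt tc f + rotInt ts g), (2 * Real.pi)⁻¹ • (rotInt tc g - rotInt ts f),
    ?_, ?_, ?_, ?_, ?_, ?_, ?_, ?_⟩
  · rw [tD_smul, tD_add, hc, hs, ← smul_neg]; congr 1; ring
  · rw [tD_smul, tD_sub, hc, hs]; congr 1; ring
  iterate 4 simp [pd_two_rotInt, hf, hg, hz]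
  · rw [tD_smul, ← smul_add]
    refine key _ _ _ ?_
    rw [tD_add, htc, hts]; ring
  · rw [tD_smul, ← smul_sub]
    refine key _ _ _ ?_
    rw [tD_sub, htc, hts]; ring

end rotations

/-! ### Rotation invariant functions and planar vector fields. -/

section invariant

/-- The function `x² + y²`. -/
def rho : Smooth 3 := coord 0 * coord 0 + coord 1 * coord 1

lemma tD_rho : tD rho = 0 := by
  simp only [rho, tD_add, tD_mul, tD_coord_zero, tD_coord_one]; ring

lemma rho_mul_cancel {f g : Smooth 3} (h : rho * f = rho * g) : f = g := by
  refine mul_left_cancel_of_dense ((dense_coord_ne (0 : Fin 3)).mono fun p hp => ?_) h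
  have : p 0 ≠ 0 := hp
  have h2 : 0 < p 0 * p 0 + p 1 * p 1 := by
    have := mul_self_pos.2 this
    have := mul_self_nonneg (p 1)
    positivity
  exact h2.ne'

lemma eq_zero_of_coord_mul {n : ℕ} {i : Fin n} {f : Smooth n} (h : coord i * f = 0) : f = 0 :=
  coord_mul_cancel (h.trans (mul_zero (coord i)).symm)

lemma eq_zero_of_rho_mul {f : Smooth 3} (h : rho * f = 0) : f = 0 :=
  rho_mul_cancel (h.trans (mul_zero rho).symm)

/-- The `(x, y)`-gradient of an invariant function is an invariant multiple of `(x, y)`. -/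
lemma exists_gradient_eq {w : Smooth 3} (h : tD w = 0) :
    ∃ k, pd 0 w = coord 0 * k ∧ pd 1 w = coord 1 * k ∧ tD k = 0 := by
  -- The equation `T w = 0` reads `x ∂_y w = y ∂_x w`, a Koszul relation.
  obtain ⟨k, h0, h1⟩ := exists_of_coord_mul_eq (i := (0 : Fin 3)) (j := 1) (by decide)
    (sub_eq_zero.1 h).symm
  refine ⟨k, h0, h1, eq_zero_of_coord_mul (i := 0) ?_⟩
  -- The commutator `[T, ∂_x] = -∂_y`, applied to `w`, gives `x T(k) = 0`.
  have h2 : tD (pd 0 w) = pd 0 (tD w) - pd 1 w := by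
    simp [tD, pd_coord, pd_comm 1 0]
    ring
  rw [h, map_zero, h0, h1, tD_mul, tD_coord_zero] at h2
  linear_combination h2

/-- Combined with `exists_gradient_eq`, this makes `k` a Casimir whenever `w` is one, which the
brackets with Casimirs require. -/
lemma pd_two_gradient {w k : Smooth 3} (hw : pd 2 w = 0) (h : pd 0 w = coord 0 * k) :
    pd 2 k = 0 := by
  have h2 := pd_comm 2 0 w
  rw [hw, h, Derivation.leibniz, pd_coord] at h2
  exact eq_zero_of_coord_mul (i := 0) (by simpa using h2)

lemma val_dil_axis (w : Smooth 3) (p : Fin 3 → ℝ) :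
    w.1 (dil {0, 1} 0 p) = w.1 ![0, 0, p 2] := by
  refine congrArg w.1 ?_
  ext i; fin_cases i <;> simp

lemma exists_eq_of_axis {w : Smooth 3} (h : ∀ z, w.1 ![0, 0, z] = 0) :
    ∃ f g, w = coord 0 * f + coord 1 * g := by
  refine ⟨dilInt {0, 1} 0 (pd 0 w), dilInt {0, 1} 0 (pd 1 w), Smooth.ext fun p => ?_⟩
  have h1 := hadamard {0, 1} w p
  rw [val_dil_axis, h, sub_zero, Finset.sum_pair (by decide)] at h1
  exact h1

/-- An invariant function which vanishes on the `z`-axis is an invariant multiple of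
`x² + y²`. -/
lemma exists_eq_rho_mul {w : Smooth 3} (hw : tD w = 0) (h : ∀ z, w.1 ![0, 0, z] = 0) :
    ∃ k, w = rho * k ∧ tD k = 0 := by
  obtain ⟨k, h0, h1, -⟩ := exists_gradient_eq hw
  -- Since the gradient is `k · (x, y)`, Hadamard's formula becomes `w = (x² + y²) ∫₀¹ t k(δ_t p)
  -- dt`.
  have h2 : w = rho * dilInt {0, 1} 1 k := by
    refine Smooth.ext fun p => ?_
    have h3 := hadamard {0, 1} w p
    rw [val_dil_axis, h, sub_zero, Finset.sum_pair (by decide), h0, h1,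
      dilInt_coord_mul_of_mem (by simp), dilInt_coord_mul_of_mem (by simp)] at h3
    rw [h3]
    simp only [rho, val_mul, val_add, val_coord, zero_add]; ring
  refine ⟨_, h2, eq_zero_of_rho_mul ?_⟩
  rw [h2, tD_mul, tD_rho, mul_zero, add_zero] at hw
  exact hw

lemma pd_two_rho : pd 2 rho = 0 := by simp [rho, pd_coord]

lemma pd_two_of_rho_mul {w k : Smooth 3} (h : w = rho * k) (hw : pd 2 w = 0) : pd 2 k = 0 := by
  rw [h, Derivation.leibniz, pd_two_rho, smul_zero, add_zero, smul_eq_mul] at hw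
  exact eq_zero_of_rho_mul hw

/-- The rotation invariant vector fields `m ∂_x + n ∂_y` are combinations of `E` and `T` with
invariant coefficients. -/
lemma exists_of_invariant_vector {m n : Smooth 3} (hm : tD m = -n) (hn : tD n = m)
    (hm2 : pd 2 m = 0) (hn2 : pd 2 n = 0) :
    ∃ a c, m = coord 0 * a - coord 1 * c ∧ n = coord 1 * a + coord 0 * c ∧
      tD a = 0 ∧ tD c = 0 ∧ pd 2 a = 0 ∧ pd 2 c = 0 := by
  -- `E` and `T` are orthogonal of square length `ρ`. The scalar products of `(m, n)` with them are
  -- invariant and vanish on the axis, so division by `ρ` yields the coefficients `a` and `c`.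
  obtain ⟨a, ha, ha'⟩ := exists_eq_rho_mul (w := coord 0 * m + coord 1 * n)
    (by simp only [tD_add, tD_mul, hm, hn, tD_coord_zero, tD_coord_one]; ring)
    (fun z => by simp)
  obtain ⟨c, hc, hc'⟩ := exists_eq_rho_mul (w := coord 0 * n - coord 1 * m)
    (by simp only [tD_sub, tD_mul, hm, hn, tD_coord_zero, tD_coord_one]; ring)
    (fun z => by simp)
  refine ⟨a, c, rho_mul_cancel ?_, rho_mul_cancel ?_, ha', hc', pd_two_of_rho_mul ha ?_,
    pd_two_of_rho_mul hc ?_⟩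
  · rw [mul_sub, mul_left_comm, ← ha, mul_left_comm, ← hc, rho]; ring
  · rw [mul_add, mul_left_comm, ← ha, mul_left_comm, ← hc, rho]; ring
  · simp [hm2, hn2, pd_coord]
  · simp [hm2, hn2, pd_coord]

lemma tD_eq_zero_of_rot {f : Smooth 3} (h : ∀ θ p, f.1 (rot θ p) = f.1 p) : tD f = 0 := by
  refine Smooth.ext fun p => ?_
  have h1 := hasDerivAt_val_rot f 0 p
  simp only [h] at h1
  simpa [rot_zero] using h1.unique (hasDerivAt_const 0 _)

lemma rot_sq_add_sq (θ : ℝ) (p : Fin 3 → ℝ) :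
    rot θ p 0 ^ 2 + rot θ p 1 ^ 2 = p 0 ^ 2 + p 1 ^ 2 := by
  simp only [rot_apply]
  simp only [Matrix.cons_val_zero, Matrix.cons_val_one]
  linear_combination (p 0 ^ 2 + p 1 ^ 2) * Real.sin_sq_add_cos_sq θ

lemma pd_eq_zero_of_val {n : ℕ} {i : Fin n} {f : Smooth n}
    (h : ∀ p (t : ℝ), f.1 (p + t • (Pi.single i 1 : Fin n → ℝ)) = f.1 p) : pd i f = 0 := by
  refine Smooth.ext fun p => ?_
  have h1 := hasDerivAt_val_comp f
    (((hasDerivAt_id (0 : ℝ)).smul_const (Pi.single i 1 : Fin n → ℝ)).const_add p)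
  simp only [id, h, zero_smul, add_zero, one_smul] at h1
  exact h1.unique (hasDerivAt_const 0 _)

lemma val_eq_of_pd_eq_zero {n : ℕ} {i : Fin n} {f : Smooth n} (h : pd i f = 0)
    (p : Fin n → ℝ) : f.1 p = f.1 (dil {i} 0 p) := by
  have h1 := hadamard {i} f p
  rw [Finset.sum_singleton, h, dilInt_val] at h1
  simpa [sub_eq_zero] using h1

lemma tD_radial (f : SmoothHalfLine) : tD (radial f) = 0 :=
  tD_eq_zero_of_rot fun θ p => by simp only [radial, rot_sq_add_sq]

lemma pd_two_radial (f : SmoothHalfLine) : pd 2 (radial f) = 0 :=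
  pd_eq_zero_of_val fun p t => by simp [radial]

lemma tD_radialZ (f : SmoothHalfPlane) : tD (radialZ f) = 0 :=
  tD_eq_zero_of_rot fun θ p => by
    have : rot θ p 2 = p 2 := by rw [rot_apply]; rfl
    simp only [radialZ, rot_sq_add_sq, this]

lemma pd_zero_axial (g : SmoothLine) : pd 0 (axial g) = 0 :=
  pd_eq_zero_of_val fun p t => by simp [axial]

lemma pd_one_axial (g : SmoothLine) : pd 1 (axial g) = 0 :=
  pd_eq_zero_of_val fun p t => by simp [axial]

lemma tD_axial (g : SmoothLine) : tD (axial g) = 0 := by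
  simp [tD, pd_zero_axial, pd_one_axial]

lemma axial_val (g : SmoothLine) (p : Fin 3 → ℝ) : (axial g).1 p = g.1 (p 2) := rfl

lemma axial_injective {g g' : SmoothLine} (h : ∀ z, (axial g - axial g').1 ![0, 0, z] = 0) :
    g = g' :=
  Subtype.ext (funext fun z => by simpa [sub_eq_zero, axial_val] using h z)

/-- The restriction of a function to the `z`-axis. -/
def axisPart (f : Smooth 3) : SmoothLine :=
  ⟨fun z => f.1 ![0, 0, z], (smooth_contDiff f).comp (contDiff_pi.2 fun i => by
    fin_cases i
    · exact contDiff_const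
    · exact contDiff_const
    · exact contDiff_id)⟩

lemma axial_axisPart_val (f : Smooth 3) (z : ℝ) :
    (axial (axisPart f)).1 ![0, 0, z] = f.1 ![0, 0, z] := rfl

lemma sqrt_val_of_tD {f : Smooth 3} (h : tD f = 0) (h2 : pd 2 f = 0) (p : Fin 3 → ℝ) :
    f.1 p = f.1 ![√(p 0 ^ 2 + p 1 ^ 2), 0, 0] := by
  rw [val_of_tD h, val_eq_of_pd_eq_zero h2]
  refine congrArg f.1 ?_
  ext i; fin_cases i <;> simp

/-- For `s > 0` the chain rule gives `∂_x f / (2√s) = k / 2`: the singular factor cancels. The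
right-hand side is continuous at `s = 0`, so the one-sided derivative there is its limit. -/
lemma hasDerivWithinAt_sqrt_val {f k : Smooth 3} (h : pd 0 f = coord 0 * k) {s : ℝ}
    (hs : s ∈ Set.Ici (0 : ℝ)) :
    HasDerivWithinAt (fun s => f.1 ![√s, 0, 0]) (k.1 ![√s, 0, 0] / 2) (Set.Ici 0) s := by
  have hpos : ∀ s : ℝ, 0 < s →
      HasDerivAt (fun s => f.1 ![√s, 0, 0]) (k.1 ![√s, 0, 0] / 2) s := fun s hs => by
    have h1 : HasDerivAt (fun s => (![√s, 0, 0] : Fin 3 → ℝ)) ![1 / (2 * √s), 0, 0] s := by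
      refine hasDerivAt_pi.2 fun i => ?_
      fin_cases i
      · exact Real.hasDerivAt_sqrt hs.ne'
      · exact hasDerivAt_const s 0
      · exact hasDerivAt_const s 0
    refine (hasDerivAt_val_comp f h1).congr_deriv ?_
    have := (Real.sqrt_pos.2 hs).ne'
    rw [fderiv_val]
    simp [Fin.sum_univ_three, h]
    field_simp
  have hcont : ∀ f : Smooth 3, Continuous fun s : ℝ => f.1 ![√s, 0, 0] := fun f => by
    refine (continuous_val f).comp (continuous_pi fun i => ?_)
    fin_cases i
    · exact Real.continuous_sqrt
    · exact continuous_const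
    · exact continuous_const
  rcases (Set.mem_Ici.1 hs).eq_or_lt with rfl | hs
  · refine hasDerivWithinAt_Ici_of_tendsto_deriv (s := Set.Ioi 0)
      (fun x hx => (hpos x hx).differentiableAt.differentiableWithinAt)
      (hcont f).continuousWithinAt self_mem_nhdsWithin ?_
    have h2 : Filter.Tendsto (fun s : ℝ => k.1 ![√s, 0, 0] / 2) (nhdsWithin 0 (Set.Ioi 0))
        (nhds (k.1 ![√0, 0, 0] / 2)) :=
      (((hcont k).div_const 2).tendsto 0).mono_left nhdsWithin_le_nhds
    refine h2.congr' ?_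
    filter_upwards [self_mem_nhdsWithin] with x hx using (hpos x hx).deriv.symm
  · exact (hpos s hs).hasDerivWithinAt

/-- Whitney's theorem: an invariant function of `(x, y)` is a smooth function of `x² + y²`. -/
lemma contDiffOn_sqrt_val (n : ℕ) : ∀ f : Smooth 3, tD f = 0 →
    ContDiffOn ℝ n (fun s => f.1 ![√s, 0, 0]) (Set.Ici 0) := by
  induction n with
  | zero =>
    intro f hf
    obtain ⟨k, h, -⟩ := exists_gradient_eq hf
    exact contDiffOn_zero.2 fun s hs => (hasDerivWithinAt_sqrt_val h hs).continuousWithinAt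
  | succ n ih =>
    intro f hf
    -- The derivative is half the same expression for `k`, which is again invariant, so the
    -- induction hypothesis applies to it.
    obtain ⟨k, h, -, hk⟩ := exists_gradient_eq hf
    have hu := uniqueDiffOn_Ici (0 : ℝ)
    rw [Nat.cast_succ]
    refine (contDiffOn_succ_iff_derivWithin hu).2
      ⟨fun s hs => (hasDerivWithinAt_sqrt_val h hs).differentiableWithinAt, by simp, ?_⟩
    exact ((ih k hk).div_const 2).congr fun s hs =>
      (hasDerivWithinAt_sqrt_val h hs).derivWithin (hu s hs)

lemma exists_eq_radial {f : Smooth 3} (h : tD f = 0) (h2 : pd 2 f = 0) :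
    ∃ φ : SmoothHalfLine, f = radial φ :=
  ⟨⟨fun s => f.1 ![√s, 0, 0], fun s => f.1 ![√s, 0, 0],
    contDiffOn_infty.2 fun n => contDiffOn_sqrt_val n f h, fun _ => rfl⟩,
    Smooth.ext fun p => sqrt_val_of_tD h h2 p⟩

lemma radial_injective {φ ψ : SmoothHalfLine} (h : radial φ = radial ψ) : φ = ψ := by
  refine Subtype.ext (funext fun ⟨s, hs⟩ => ?_)
  have h1 := congrArg (fun f : Smooth 3 => f.1 ![√s, 0, 0]) h
  simpa [radial, Real.sq_sqrt (Set.mem_Ici.1 hs)] using h1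

end invariant

/-! ### The wedge product, the bracket and `d_π` in components. -/

section components

/-- The multivector field on `ℝ³` with the given components with respect to
`1, ∂_x, ∂_y, ∂_z, ∂_x ∧ ∂_y, ∂_x ∧ ∂_z, ∂_y ∧ ∂_z, ∂_x ∧ ∂_y ∧ ∂_z`. -/
def mvf (f a₀ a₁ a₂ b₀₁ b₀₂ b₁₂ t : Smooth 3) : MultiVF 3 := fun I =>
  if I = ∅ then f else if I = {0} then a₀ else if I = {1} then a₁ else if I = {2} then a₂
  else if I = {0, 1} then b₀₁ else if I = {0, 2} then b₀₂ else if I = {1, 2} then b₁₂ else t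

section apply

variable (f a₀ a₁ a₂ b₀₁ b₀₂ b₁₂ t : Smooth 3)

@[simp] lemma mvf_empty : mvf f a₀ a₁ a₂ b₀₁ b₀₂ b₁₂ t ∅ = f := rfl
@[simp] lemma mvf_0 : mvf f a₀ a₁ a₂ b₀₁ b₀₂ b₁₂ t {0} = a₀ := rfl
@[simp] lemma mvf_1 : mvf f a₀ a₁ a₂ b₀₁ b₀₂ b₁₂ t {1} = a₁ := rfl
@[simp] lemma mvf_2 : mvf f a₀ a₁ a₂ b₀₁ b₀₂ b₁₂ t {2} = a₂ := rfl
@[simp] lemma mvf_01 : mvf f a₀ a₁ a₂ b₀₁ b₀₂ b₁₂ t {0, 1} = b₀₁ := rfl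
@[simp] lemma mvf_02 : mvf f a₀ a₁ a₂ b₀₁ b₀₂ b₁₂ t {0, 2} = b₀₂ := rfl
@[simp] lemma mvf_12 : mvf f a₀ a₁ a₂ b₀₁ b₀₂ b₁₂ t {1, 2} = b₁₂ := rfl
@[simp] lemma mvf_012 : mvf f a₀ a₁ a₂ b₀₁ b₀₂ b₁₂ t {0, 1, 2} = t := rfl

end apply

lemma forall_finset_fin_three {p : Finset (Fin 3) → Prop} (he : p ∅) (h0 : p {0}) (h1 : p {1})
    (h2 : p {2}) (h01 : p {0, 1}) (h02 : p {0, 2}) (h12 : p {1, 2}) (h012 : p {0, 1, 2})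
    (I : Finset (Fin 3)) : p I := by
  have : ∀ I : Finset (Fin 3), I = ∅ ∨ I = {0} ∨ I = {1} ∨ I = {2} ∨ I = {0, 1} ∨ I = {0, 2} ∨
    I = {1, 2} ∨ I = {0, 1, 2} := by decide
  rcases this I with rfl | rfl | rfl | rfl | rfl | rfl | rfl | rfl <;> assumption

lemma eq_mvf (P : MultiVF 3) :
    P = mvf (P ∅) (P {0}) (P {1}) (P {2}) (P {0, 1}) (P {0, 2}) (P {1, 2}) (P {0, 1, 2}) :=
  funext (forall_finset_fin_three rfl rfl rfl rfl rfl rfl rfl rfl)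

lemma mvf_eq_iff {f a₀ a₁ a₂ b₀₁ b₀₂ b₁₂ t f' a₀' a₁' a₂' b₀₁' b₀₂' b₁₂' t' : Smooth 3} :
    mvf f a₀ a₁ a₂ b₀₁ b₀₂ b₁₂ t = mvf f' a₀' a₁' a₂' b₀₁' b₀₂' b₁₂' t' ↔
      f = f' ∧ a₀ = a₀' ∧ a₁ = a₁' ∧ a₂ = a₂' ∧ b₀₁ = b₀₁' ∧ b₀₂ = b₀₂' ∧ b₁₂ = b₁₂' ∧ t = t' := by
  refine ⟨fun h => ⟨congrFun h ∅, ?_, ?_, ?_, ?_, ?_, ?_, ?_⟩, ?_⟩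
  · simpa only [mvf_0] using congrFun h {0}
  · simpa only [mvf_1] using congrFun h {1}
  · simpa only [mvf_2] using congrFun h {2}
  · simpa only [mvf_01] using congrFun h {0, 1}
  · simpa only [mvf_02] using congrFun h {0, 2}
  · simpa only [mvf_12] using congrFun h {1, 2}
  · simpa only [mvf_012] using congrFun h {0, 1, 2}
  rintro ⟨rfl, rfl, rfl, rfl, rfl, rfl, rfl, rfl⟩; rfl

section operations

variable (f a₀ a₁ a₂ b₀₁ b₀₂ b₁₂ t f' a₀' a₁' a₂' b₀₁' b₀₂' b₁₂' t' : Smooth 3)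

lemma wedge_mvf : wedge (mvf f a₀ a₁ a₂ b₀₁ b₀₂ b₁₂ t) (mvf f' a₀' a₁' a₂' b₀₁' b₀₂' b₁₂' t') =
    mvf (f * f') (f * a₀' + a₀ * f') (f * a₁' + a₁ * f') (f * a₂' + a₂ * f')
      (f * b₀₁' + a₀ * a₁' - a₁ * a₀' + b₀₁ * f') (f * b₀₂' + a₀ * a₂' - a₂ * a₀' + b₀₂ * f')
      (f * b₁₂' + a₁ * a₂' - a₂ * a₁' + b₁₂ * f')
      (f * t' + a₀ * b₁₂' - a₁ * b₀₂' + a₂ * b₀₁' + b₀₁ * a₂' - b₀₂ * a₁' + b₁₂ * a₀' + t * f') := by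
  -- With the subsets of `K` listed explicitly, every shuffle sign becomes a decidable numerical
  -- fact.
  have key : ∀ (P Q : MultiVF 3) (K : Finset (Fin 3)) (L : List (Finset (Fin 3))), L.Nodup →
      K.powerset = L.toFinset →
      wedge P Q K = (L.map fun I => shuffleSign I (K \ I) • (P I * Q (K \ I))).sum := by
    intro P Q K L hL h
    rw [wedge, h, List.sum_toFinset _ hL]
  refine funext (forall_finset_fin_three ?_ ?_ ?_ ?_ ?_ ?_ ?_ ?_)
  · rw [key _ _ ∅ [∅] (by decide) (by decide)]
    simp [show shuffleSign (∅ : Finset (Fin 3)) ∅ = 1 by decide]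
  · rw [key _ _ {0} [∅, {0}] (by decide) (by decide)]
    simp [shuffleSign]
  · rw [key _ _ {1} [∅, {1}] (by decide) (by decide)]
    simp [shuffleSign]
  · rw [key _ _ {2} [∅, {2}] (by decide) (by decide)]
    simp [shuffleSign]
  · rw [key _ _ {0, 1} [∅, {0}, {1}, {0, 1}] (by decide) (by decide)]
    simp only [List.map_cons, List.map_nil, List.sum_cons, List.sum_nil,
      show ({0, 1} \ ∅ : Finset (Fin 3)) = {0, 1} by decide,
      show ({0, 1} \ {0} : Finset (Fin 3)) = {1} by decide,
      show ({0, 1} \ {1} : Finset (Fin 3)) = {0} by decide,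
      show ({0, 1} \ {0, 1} : Finset (Fin 3)) = ∅ by decide,
      show shuffleSign (∅ : Finset (Fin 3)) {0, 1} = 1 by decide,
      show shuffleSign ({0} : Finset (Fin 3)) {1} = 1 by decide,
      show shuffleSign ({1} : Finset (Fin 3)) {0} = -1 by decide,
      show shuffleSign ({0, 1} : Finset (Fin 3)) ∅ = 1 by decide,
      mvf_empty, mvf_0, mvf_1, mvf_01, one_smul, neg_smul]
    ring
  · rw [key _ _ {0, 2} [∅, {0}, {2}, {0, 2}] (by decide) (by decide)]
    simp only [List.map_cons, List.map_nil, List.sum_cons, List.sum_nil,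
      show ({0, 2} \ ∅ : Finset (Fin 3)) = {0, 2} by decide,
      show ({0, 2} \ {0} : Finset (Fin 3)) = {2} by decide,
      show ({0, 2} \ {2} : Finset (Fin 3)) = {0} by decide,
      show ({0, 2} \ {0, 2} : Finset (Fin 3)) = ∅ by decide,
      show shuffleSign (∅ : Finset (Fin 3)) {0, 2} = 1 by decide,
      show shuffleSign ({0} : Finset (Fin 3)) {2} = 1 by decide,
      show shuffleSign ({2} : Finset (Fin 3)) {0} = -1 by decide,
      show shuffleSign ({0, 2} : Finset (Fin 3)) ∅ = 1 by decide,
      mvf_empty, mvf_0, mvf_2, mvf_02, one_smul, neg_smul]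
    ring
  · rw [key _ _ {1, 2} [∅, {1}, {2}, {1, 2}] (by decide) (by decide)]
    simp only [List.map_cons, List.map_nil, List.sum_cons, List.sum_nil,
      show ({1, 2} \ ∅ : Finset (Fin 3)) = {1, 2} by decide,
      show ({1, 2} \ {1} : Finset (Fin 3)) = {2} by decide,
      show ({1, 2} \ {2} : Finset (Fin 3)) = {1} by decide,
      show ({1, 2} \ {1, 2} : Finset (Fin 3)) = ∅ by decide,
      show shuffleSign (∅ : Finset (Fin 3)) {1, 2} = 1 by decide,
      show shuffleSign ({1} : Finset (Fin 3)) {2} = 1 by decide,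
      show shuffleSign ({2} : Finset (Fin 3)) {1} = -1 by decide,
      show shuffleSign ({1, 2} : Finset (Fin 3)) ∅ = 1 by decide,
      mvf_empty, mvf_1, mvf_2, mvf_12, one_smul, neg_smul]
    ring
  · rw [key _ _ {0, 1, 2} [∅, {0}, {1}, {2}, {0, 1}, {0, 2}, {1, 2}, {0, 1, 2}]
      (by decide) (by decide)]
    simp only [List.map_cons, List.map_nil, List.sum_cons, List.sum_nil,
      show ({0, 1, 2} \ ∅ : Finset (Fin 3)) = {0, 1, 2} by decide,
      show ({0, 1, 2} \ {0} : Finset (Fin 3)) = {1, 2} by decide,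
      show ({0, 1, 2} \ {1} : Finset (Fin 3)) = {0, 2} by decide,
      show ({0, 1, 2} \ {2} : Finset (Fin 3)) = {0, 1} by decide,
      show ({0, 1, 2} \ {0, 1} : Finset (Fin 3)) = {2} by decide,
      show ({0, 1, 2} \ {0, 2} : Finset (Fin 3)) = {1} by decide,
      show ({0, 1, 2} \ {1, 2} : Finset (Fin 3)) = {0} by decide,
      show ({0, 1, 2} \ {0, 1, 2} : Finset (Fin 3)) = ∅ by decide,
      show shuffleSign (∅ : Finset (Fin 3)) {0, 1, 2} = 1 by decide,
      show shuffleSign ({0} : Finset (Fin 3)) {1, 2} = 1 by decide,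
      show shuffleSign ({1} : Finset (Fin 3)) {0, 2} = -1 by decide,
      show shuffleSign ({2} : Finset (Fin 3)) {0, 1} = 1 by decide,
      show shuffleSign ({0, 1} : Finset (Fin 3)) {2} = 1 by decide,
      show shuffleSign ({0, 2} : Finset (Fin 3)) {1} = -1 by decide,
      show shuffleSign ({1, 2} : Finset (Fin 3)) {0} = 1 by decide,
      show shuffleSign ({0, 1, 2} : Finset (Fin 3)) ∅ = 1 by decide,
      mvf_empty, mvf_0, mvf_1, mvf_2, mvf_01, mvf_02, mvf_12, mvf_012, one_smul, neg_smul]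
    ring

lemma leftD_of_mem {n : ℕ} {i : Fin n} {J : Finset (Fin n)} (P : MultiVF n) (h : i ∈ J) :
    leftD i P J = 0 := if_pos h

lemma rightD_of_mem {n : ℕ} {i : Fin n} {J : Finset (Fin n)} (P : MultiVF n) (h : i ∈ J) :
    rightD i P J = 0 := if_pos h

lemma leftD_eq {n : ℕ} {i : Fin n} {J K : Finset (Fin n)} {e : ℤ} (P : MultiVF n) (h : i ∉ J)
    (hK : insert i J = K) (he : shuffleSign {i} J = e) : leftD i P J = e • P K := by
  rw [leftD, if_neg h, hK, he]

lemma rightD_eq {n : ℕ} {i : Fin n} {J K : Finset (Fin n)} {e : ℤ} (P : MultiVF n) (h : i ∉ J)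
    (hK : insert i J = K) (he : shuffleSign J {i} = e) : rightD i P J = e • P K := by
  rw [rightD, if_neg h, hK, he]

lemma leftD_mvf_0 : leftD 0 (mvf f a₀ a₁ a₂ b₀₁ b₀₂ b₁₂ t) = mvf a₀ 0 b₀₁ b₀₂ 0 0 t 0 := by
  refine funext (forall_finset_fin_three ?_ ?_ ?_ ?_ ?_ ?_ ?_ ?_)
  · exact (leftD_eq (K := {0}) (e := 1) _ (by decide) (by decide) (by decide)).trans (by simp)
  · exact leftD_of_mem _ (by decide)
  · exact (leftD_eq (K := {0, 1}) (e := 1) _ (by decide) (by decide) (by decide)).trans (by simp)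
  · exact (leftD_eq (K := {0, 2}) (e := 1) _ (by decide) (by decide) (by decide)).trans (by simp)
  · exact leftD_of_mem _ (by decide)
  · exact leftD_of_mem _ (by decide)
  · exact (leftD_eq (K := {0, 1, 2}) (e := 1) _ (by decide) (by decide) (by decide)).trans (by simp)
  · exact leftD_of_mem _ (by decide)

lemma leftD_mvf_1 : leftD 1 (mvf f a₀ a₁ a₂ b₀₁ b₀₂ b₁₂ t) = mvf a₁ (-b₀₁) 0 b₁₂ 0 (-t) 0 0 := by
  refine funext (forall_finset_fin_three ?_ ?_ ?_ ?_ ?_ ?_ ?_ ?_)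
  · exact (leftD_eq (K := {1}) (e := 1) _ (by decide) (by decide) (by decide)).trans (by simp)
  · exact (leftD_eq (K := {0, 1}) (e := -1) _ (by decide) (by decide) (by decide)).trans (by simp)
  · exact leftD_of_mem _ (by decide)
  · exact (leftD_eq (K := {1, 2}) (e := 1) _ (by decide) (by decide) (by decide)).trans (by simp)
  · exact leftD_of_mem _ (by decide)
  · exact (leftD_eq (K := {0, 1, 2}) (e := -1) _ (by decide) (by decide) (by decide)).trans (by simp)
  · exact leftD_of_mem _ (by decide)
  · exact leftD_of_mem _ (by decide)

lemma leftD_mvf_2 : leftD 2 (mvf f a₀ a₁ a₂ b₀₁ b₀₂ b₁₂ t) = mvf a₂ (-b₀₂) (-b₁₂) 0 t 0 0 0 := by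
  refine funext (forall_finset_fin_three ?_ ?_ ?_ ?_ ?_ ?_ ?_ ?_)
  · exact (leftD_eq (K := {2}) (e := 1) _ (by decide) (by decide) (by decide)).trans (by simp)
  · exact (leftD_eq (K := {0, 2}) (e := -1) _ (by decide) (by decide) (by decide)).trans (by simp)
  · exact (leftD_eq (K := {1, 2}) (e := -1) _ (by decide) (by decide) (by decide)).trans (by simp)
  · exact leftD_of_mem _ (by decide)
  · exact (leftD_eq (K := {0, 1, 2}) (e := 1) _ (by decide) (by decide) (by decide)).trans (by simp)
  · exact leftD_of_mem _ (by decide)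
  · exact leftD_of_mem _ (by decide)
  · exact leftD_of_mem _ (by decide)

lemma rightD_mvf_0 :
    rightD 0 (mvf f a₀ a₁ a₂ b₀₁ b₀₂ b₁₂ t) = mvf a₀ 0 (-b₀₁) (-b₀₂) 0 0 t 0 := by
  refine funext (forall_finset_fin_three ?_ ?_ ?_ ?_ ?_ ?_ ?_ ?_)
  · exact (rightD_eq (K := {0}) (e := 1) _ (by decide) (by decide) (by decide)).trans (by simp)
  · exact rightD_of_mem _ (by decide)
  · exact (rightD_eq (K := {0, 1}) (e := -1) _ (by decide) (by decide) (by decide)).trans (by simp)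
  · exact (rightD_eq (K := {0, 2}) (e := -1) _ (by decide) (by decide) (by decide)).trans (by simp)
  · exact rightD_of_mem _ (by decide)
  · exact rightD_of_mem _ (by decide)
  · exact (rightD_eq (K := {0, 1, 2}) (e := 1) _ (by decide) (by decide) (by decide)).trans (by simp)
  · exact rightD_of_mem _ (by decide)

lemma rightD_mvf_1 :
    rightD 1 (mvf f a₀ a₁ a₂ b₀₁ b₀₂ b₁₂ t) = mvf a₁ b₀₁ 0 (-b₁₂) 0 (-t) 0 0 := by
  refine funext (forall_finset_fin_three ?_ ?_ ?_ ?_ ?_ ?_ ?_ ?_)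
  · exact (rightD_eq (K := {1}) (e := 1) _ (by decide) (by decide) (by decide)).trans (by simp)
  · exact (rightD_eq (K := {0, 1}) (e := 1) _ (by decide) (by decide) (by decide)).trans (by simp)
  · exact rightD_of_mem _ (by decide)
  · exact (rightD_eq (K := {1, 2}) (e := -1) _ (by decide) (by decide) (by decide)).trans (by simp)
  · exact rightD_of_mem _ (by decide)
  · exact (rightD_eq (K := {0, 1, 2}) (e := -1) _ (by decide) (by decide) (by decide)).trans (by simp)
  · exact rightD_of_mem _ (by decide)
  · exact rightD_of_mem _ (by decide)

lemma rightD_mvf_2 :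
    rightD 2 (mvf f a₀ a₁ a₂ b₀₁ b₀₂ b₁₂ t) = mvf a₂ b₀₂ b₁₂ 0 t 0 0 0 := by
  refine funext (forall_finset_fin_three ?_ ?_ ?_ ?_ ?_ ?_ ?_ ?_)
  · exact (rightD_eq (K := {2}) (e := 1) _ (by decide) (by decide) (by decide)).trans (by simp)
  · exact (rightD_eq (K := {0, 2}) (e := 1) _ (by decide) (by decide) (by decide)).trans (by simp)
  · exact (rightD_eq (K := {1, 2}) (e := 1) _ (by decide) (by decide) (by decide)).trans (by simp)
  · exact rightD_of_mem _ (by decide)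
  · exact (rightD_eq (K := {0, 1, 2}) (e := 1) _ (by decide) (by decide) (by decide)).trans (by simp)
  · exact rightD_of_mem _ (by decide)
  · exact rightD_of_mem _ (by decide)
  · exact rightD_of_mem _ (by decide)

lemma coeffD_mvf (i : Fin 3) : coeffD i (mvf f a₀ a₁ a₂ b₀₁ b₀₂ b₁₂ t) =
    mvf (pd i f) (pd i a₀) (pd i a₁) (pd i a₂) (pd i b₀₁) (pd i b₀₂) (pd i b₁₂) (pd i t) :=
  funext (forall_finset_fin_three rfl rfl rfl rfl rfl rfl rfl rfl)

lemma mvf_add : mvf f a₀ a₁ a₂ b₀₁ b₀₂ b₁₂ t + mvf f' a₀' a₁' a₂' b₀₁' b₀₂' b₁₂' t' =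
    mvf (f + f') (a₀ + a₀') (a₁ + a₁') (a₂ + a₂') (b₀₁ + b₀₁') (b₀₂ + b₀₂') (b₁₂ + b₁₂')
      (t + t') :=
  funext (forall_finset_fin_three rfl rfl rfl rfl rfl rfl rfl rfl)

lemma mvf_sub : mvf f a₀ a₁ a₂ b₀₁ b₀₂ b₁₂ t - mvf f' a₀' a₁' a₂' b₀₁' b₀₂' b₁₂' t' =
    mvf (f - f') (a₀ - a₀') (a₁ - a₁') (a₂ - a₂') (b₀₁ - b₀₁') (b₀₂ - b₀₂') (b₁₂ - b₁₂')
      (t - t') :=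
  funext (forall_finset_fin_three rfl rfl rfl rfl rfl rfl rfl rfl)

lemma smul_mvf (c : Smooth 3) : c • mvf f a₀ a₁ a₂ b₀₁ b₀₂ b₁₂ t =
    mvf (c * f) (c * a₀) (c * a₁) (c * a₂) (c * b₀₁) (c * b₀₂) (c * b₁₂) (c * t) :=
  funext (forall_finset_fin_three rfl rfl rfl rfl rfl rfl rfl rfl)

lemma zero_eq_mvf : (0 : MultiVF 3) = mvf 0 0 0 0 0 0 0 0 := eq_mvf 0

lemma ofFun_eq_mvf : ofFun f = mvf f 0 0 0 0 0 0 0 :=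
  funext (forall_finset_fin_three rfl rfl rfl rfl rfl rfl rfl rfl)

lemma dd_0_eq_mvf : dd (n := 3) {0} = mvf 0 1 0 0 0 0 0 0 :=
  funext (forall_finset_fin_three rfl rfl rfl rfl rfl rfl rfl rfl)

lemma dd_1_eq_mvf : dd (n := 3) {1} = mvf 0 0 1 0 0 0 0 0 :=
  funext (forall_finset_fin_three rfl rfl rfl rfl rfl rfl rfl rfl)

lemma vfZ_eq_mvf : vfZ = mvf 0 0 0 1 0 0 0 0 :=
  funext (forall_finset_fin_three rfl rfl rfl rfl rfl rfl rfl rfl)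

lemma vfE_eq_mvf : vfE = mvf 0 (coord 0) (coord 1) 0 0 0 0 0 := by
  simp [vfE, dd_0_eq_mvf, dd_1_eq_mvf, smul_mvf, mvf_add]

lemma vec_eq_mvf : vec f f' = mvf 0 (f * coord 0) (f * coord 1) f' 0 0 0 0 := by
  simp [vec, vfE_eq_mvf, vfZ_eq_mvf, smul_mvf, mvf_add]

lemma dxy_eq_mvf : dxy = mvf 0 0 0 0 1 0 0 0 := by
  simp [dxy, dd_0_eq_mvf, dd_1_eq_mvf, wedge_mvf]

lemma dxyz_eq_mvf : dxyz = mvf 0 0 0 0 0 0 0 1 := by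
  simp [dxyz, dxy_eq_mvf, vfZ_eq_mvf, wedge_mvf]

lemma biv_eq_mvf : biv f f' = mvf 0 0 0 0 f' (f * coord 0) (f * coord 1) 0 := by
  simp [biv, vfE_eq_mvf, vfZ_eq_mvf, dxy_eq_mvf, wedge_mvf, smul_mvf, mvf_add]

lemma tri_eq_mvf : tri f = mvf 0 0 0 0 0 0 0 f := by
  simp [tri, dxyz_eq_mvf, smul_mvf]

lemma piE2_eq_mvf : piE2 = mvf 0 0 0 0 0 (-coord 1) (coord 0) 0 := by
  have h : vfT = (-coord 1 : Smooth 3) • dd {0} + (coord 0 : Smooth 3) • dd {1} := by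
    rw [vfT, neg_smul]
  rw [piE2, h, dd_0_eq_mvf, dd_1_eq_mvf, vfZ_eq_mvf, smul_mvf, smul_mvf, mvf_add, wedge_mvf]
  simp

/-- The Poisson differential in components. -/
lemma schouten_piE2_mvf : schouten piE2 (mvf f a₀ a₁ a₂ b₀₁ b₀₂ b₁₂ t) =
    mvf 0 (-(coord 1 * pd 2 f)) (coord 0 * pd 2 f) (-tD f)
      (-(coord 0 * pd 2 a₀) - coord 1 * pd 2 a₁) (tD a₀ + a₁ - coord 1 * pd 2 a₂)
      (tD a₁ - a₀ + coord 0 * pd 2 a₂) (-tD b₀₁ - coord 0 * pd 2 b₀₂ - coord 1 * pd 2 b₁₂) := by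
  simp only [schouten, Fin.sum_univ_three, piE2_eq_mvf, leftD_mvf_0, leftD_mvf_1, leftD_mvf_2,
    rightD_mvf_0, rightD_mvf_1, rightD_mvf_2, coeffD_mvf, wedge_mvf, mvf_add, mvf_sub, mvf_eq_iff,
    map_zero, map_neg, pd_coord, tD]
  refine ⟨?_, ?_, ?_, ?_, ?_, ?_, ?_, ?_⟩ <;> simp <;> ring

end operations

end components

/-! ### The Poisson complex, its cocycles and its coboundaries. -/

section complex

lemma pd_two_coord_zero : pd 2 (coord 0 : Smooth 3) = 0 := by simp [pd_coord]

lemma pd_two_coord_one : pd 2 (coord 1 : Smooth 3) = 0 := by simp [pd_coord]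

lemma pd_two_coord_two : pd 2 (coord 2 : Smooth 3) = 1 := by simp [pd_coord]

lemma pd_mul {n : ℕ} (i : Fin n) (f g : Smooth n) : pd i (f * g) = f * pd i g + g * pd i f :=
  (pd i).leibniz f g

lemma tD_coord_two : tD (coord 2) = 0 := by simp [tD, pd_coord]

/-- `T` involves only `x` and `y`, so it commutes with integration in `z`; antiderivatives of
invariant functions are invariant. -/
lemma tD_antiD (f : Smooth 3) : tD (antiD 2 f) = antiD 2 (tD f) := by
  have h : ∀ f g : Smooth 3, antiD 2 (f - g) = antiD 2 f - antiD 2 g := fun f g => by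
    rw [eq_sub_iff_add_eq, ← antiD_add, sub_add_cancel]
  rw [tD, tD, h, pd_antiD_of_ne (by decide), pd_antiD_of_ne (by decide),
    antiD_coord_mul (by decide), antiD_coord_mul (by decide)]

lemma antiD_zero (i : Fin 3) : antiD i (0 : Smooth 3) = 0 := by
  have := antiD_add i (0 : Smooth 3) 0
  rwa [add_zero, left_eq_add] at this

lemma isPoisson_piE2 : IsPoisson piE2 := by
  refine ⟨?_, ?_⟩
  · rw [piE2_eq_mvf]
    exact forall_finset_fin_three (fun _ => rfl) (fun _ => rfl) (fun _ => rfl) (fun _ => rfl)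
      (fun _ => rfl) (fun h => absurd rfl h) (fun h => absurd rfl h) (fun _ => rfl)
  · have h := schouten_piE2_mvf 0 0 0 0 0 (-coord 1) (coord 0) 0
    rw [← piE2_eq_mvf] at h
    rw [h, zero_eq_mvf]
    simp [tD, pd_coord]

/-- The Poisson differential squares to zero. -/
lemma schouten_piE2_schouten_piE2 (P : MultiVF 3) : schouten piE2 (schouten piE2 P) = 0 := by
  rw [eq_mvf P, schouten_piE2_mvf, schouten_piE2_mvf, zero_eq_mvf, mvf_eq_iff]
  simp only [tD_sub, tD_neg, tD_mul, tD_zero, map_add, map_sub, map_neg, map_zero, pd_mul,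
    pd_two_tD, pd_two_coord_zero, pd_two_coord_one, tD_coord_zero, tD_coord_one]
  refine ⟨trivial, ?_, ?_, ?_, ?_, ?_, ?_, ?_⟩ <;> ring

lemma mvf_mem_homog_zero (f : Smooth 3) : mvf f 0 0 0 0 0 0 0 ∈ homog 3 0 :=
  forall_finset_fin_three (fun h => absurd rfl h) (fun _ => rfl) (fun _ => rfl) (fun _ => rfl)
    (fun _ => rfl) (fun _ => rfl) (fun _ => rfl) (fun _ => rfl)

lemma mvf_mem_homog_one (a₀ a₁ a₂ : Smooth 3) : mvf 0 a₀ a₁ a₂ 0 0 0 0 ∈ homog 3 1 :=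
  forall_finset_fin_three (fun _ => rfl) (fun h => absurd rfl h) (fun h => absurd rfl h)
    (fun h => absurd rfl h) (fun _ => rfl) (fun _ => rfl) (fun _ => rfl) (fun _ => rfl)

lemma mvf_mem_homog_two (b₀₁ b₀₂ b₁₂ : Smooth 3) : mvf 0 0 0 0 b₀₁ b₀₂ b₁₂ 0 ∈ homog 3 2 :=
  forall_finset_fin_three (fun _ => rfl) (fun _ => rfl) (fun _ => rfl) (fun _ => rfl)
    (fun h => absurd rfl h) (fun h => absurd rfl h) (fun h => absurd rfl h) (fun _ => rfl)

lemma mvf_mem_homog_three (t : Smooth 3) : mvf 0 0 0 0 0 0 0 t ∈ homog 3 3 :=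
  forall_finset_fin_three (fun _ => rfl) (fun _ => rfl) (fun _ => rfl) (fun _ => rfl)
    (fun _ => rfl) (fun _ => rfl) (fun _ => rfl) (fun h => absurd rfl h)

lemma eq_mvf_of_homog_zero {P : MultiVF 3} (h : P ∈ homog 3 0) : ∃ f, P = mvf f 0 0 0 0 0 0 0 :=
  ⟨P ∅, funext (forall_finset_fin_three rfl (h _ (by decide)) (h _ (by decide)) (h _ (by decide))
    (h _ (by decide)) (h _ (by decide)) (h _ (by decide)) (h _ (by decide)))⟩

lemma eq_mvf_of_homog_one {P : MultiVF 3} (h : P ∈ homog 3 1) :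
    ∃ a₀ a₁ a₂, P = mvf 0 a₀ a₁ a₂ 0 0 0 0 :=
  ⟨P {0}, P {1}, P {2}, funext (forall_finset_fin_three (h _ (by decide)) rfl rfl rfl
    (h _ (by decide)) (h _ (by decide)) (h _ (by decide)) (h _ (by decide)))⟩

lemma eq_mvf_of_homog_two {P : MultiVF 3} (h : P ∈ homog 3 2) :
    ∃ b₀₁ b₀₂ b₁₂, P = mvf 0 0 0 0 b₀₁ b₀₂ b₁₂ 0 :=
  ⟨P {0, 1}, P {0, 2}, P {1, 2}, funext (forall_finset_fin_three (h _ (by decide))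
    (h _ (by decide)) (h _ (by decide)) (h _ (by decide)) rfl rfl rfl (h _ (by decide)))⟩

lemma eq_mvf_of_homog_three {P : MultiVF 3} (h : P ∈ homog 3 3) :
    ∃ t, P = mvf 0 0 0 0 0 0 0 t :=
  ⟨P {0, 1, 2}, funext (forall_finset_fin_three (h _ (by decide)) (h _ (by decide))
    (h _ (by decide)) (h _ (by decide)) (h _ (by decide)) (h _ (by decide)) (h _ (by decide)) rfl)⟩

/-- In `d_π u = (∂_z u) T - T(u) ∂_z` the coefficient of `T` can be cancelled because `T` is nonzero
on a dense set. -/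
lemma mem_casimirs_iff {u : Smooth 3} : u ∈ casimirs piE2 ↔ tD u = 0 ∧ pd 2 u = 0 := by
  change schouten piE2 (ofFun u) = 0 ↔ _
  rw [ofFun_eq_mvf, schouten_piE2_mvf, zero_eq_mvf, mvf_eq_iff]
  constructor
  · rintro ⟨-, -, h1, h2, -⟩
    exact ⟨neg_eq_zero.1 h2, eq_zero_of_coord_mul h1⟩
  · rintro ⟨h1, h2⟩
    simp [h1, h2, tD_zero]

lemma ofFun_mem_cocycles {u : Smooth 3} (h : u ∈ casimirs piE2) : ofFun u ∈ cocycles piE2 0 :=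
  ⟨by rw [ofFun_eq_mvf]; exact mvf_mem_homog_zero u, h⟩

lemma vec_mem_cocycles {a b : Smooth 3} (ha : a ∈ casimirs piE2) (hb : b ∈ casimirs piE2) :
    vec a b ∈ cocycles piE2 1 := by
  rw [mem_casimirs_iff] at ha hb
  refine ⟨by rw [vec_eq_mvf]; exact mvf_mem_homog_one _ _ _, ?_⟩
  rw [vec_eq_mvf, schouten_piE2_mvf, zero_eq_mvf, mvf_eq_iff]
  simp [tD_mul, ha, hb, tD_coord_zero, tD_coord_one, tD_zero, pd_coord, mul_comm]

lemma biv_mem_cocycles {c k : Smooth 3} (hc : pd 2 c = 0) (hk : tD k = 0) :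
    biv c k ∈ cocycles piE2 2 := by
  refine ⟨by rw [biv_eq_mvf]; exact mvf_mem_homog_two _ _ _, ?_⟩
  rw [biv_eq_mvf, schouten_piE2_mvf, zero_eq_mvf, mvf_eq_iff]
  simp [hc, hk, tD_zero, pd_coord]

lemma tri_mem_cocycles (k : Smooth 3) : tri k ∈ cocycles piE2 3 := by
  refine ⟨by rw [tri_eq_mvf]; exact mvf_mem_homog_three _, ?_⟩
  rw [tri_eq_mvf, schouten_piE2_mvf, zero_eq_mvf, mvf_eq_iff]
  simp [tD_zero]

/-! ### Representatives of cohomology classes. -/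

section classes

variable {n k : ℕ} {π : MultiVF n} {P Q : MultiVF n} {c : H π k}

lemma Represents.sub_mem (hP : Represents P c) (hQ : Represents Q c) :
    P - Q ∈ coboundaries π k := by
  obtain ⟨h1, rfl⟩ := hP
  obtain ⟨h2, h⟩ := hQ
  exact (Submodule.Quotient.eq ((coboundaries π k).comap (cocycles π k).subtype)).1 h.symm

lemma Represents.congr (hP : Represents P c) (hQ : Q ∈ cocycles π k)
    (h : P - Q ∈ coboundaries π k) : Represents Q c := by
  obtain ⟨h1, rfl⟩ := hP
  exact ⟨hQ, ((Submodule.Quotient.eq ((coboundaries π k).comap (cocycles π k).subtype)).2 h).symm⟩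

lemma exists_represents (c : H π k) : ∃ P ∈ cocycles π k, Represents P c := by
  obtain ⟨⟨P, hP⟩, rfl⟩ := Submodule.Quotient.mk_surjective _ c
  exact ⟨P, hP, hP, rfl⟩

lemma SameClass.refl (hP : P ∈ cocycles π k) : SameClass π k P P :=
  ⟨_, ⟨hP, rfl⟩, hP, rfl⟩

lemma SameClass.trans {R : MultiVF n} (h : SameClass π k P Q) (h' : SameClass π k Q R) :
    SameClass π k P R := by
  obtain ⟨c, hP, hQ, hc⟩ := h
  obtain ⟨c', ⟨hQ', hc'⟩, hR⟩ := h'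
  exact ⟨c, hP, hc ▸ hc' ▸ hR⟩

end classes

lemma mem_coboundaries_zero {P : MultiVF 3} (h : P ∈ coboundaries piE2 0) : P = 0 := by
  rcases h with h | ⟨j, hj, -⟩
  · exact h
  · omega

lemma mem_coboundaries_succ {k : ℕ} {P : MultiVF 3} (h : P ∈ coboundaries piE2 (k + 1)) :
    ∃ Q ∈ homog 3 k, P = schouten piE2 Q := by
  rcases h with rfl | ⟨j, hj, Q, hQ, rfl⟩
  · refine ⟨0, zero_mem _, ?_⟩
    rw [zero_eq_mvf, schouten_piE2_mvf]
    simp [tD_zero]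
  · obtain rfl : j = k := by omega
    exact ⟨Q, hQ, rfl⟩

lemma Represents.of_eq_add {k : ℕ} {P Q R : MultiVF 3} {c : H piE2 (k + 1)} (hP : Represents P c)
    (hQ : Q ∈ cocycles piE2 (k + 1)) (hR : R ∈ homog 3 k) (h : P = Q + schouten piE2 R) :
    Represents Q c :=
  hP.congr hQ (Or.inr ⟨k, rfl, R, hR, by rw [h, add_sub_cancel_left]⟩)

lemma schouten_piE2_mem_homog {k : ℕ} {R : MultiVF 3} (hR : R ∈ homog 3 k) :
    schouten piE2 R ∈ homog 3 (k + 1) := by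
  rcases k with _ | _ | _ | k
  · obtain ⟨f, rfl⟩ := eq_mvf_of_homog_zero hR
    rw [schouten_piE2_mvf]
    simpa [tD_zero] using mvf_mem_homog_one _ _ _
  · obtain ⟨a₀, a₁, a₂, rfl⟩ := eq_mvf_of_homog_one hR
    rw [schouten_piE2_mvf]
    simpa [tD_zero] using mvf_mem_homog_two _ _ _
  · obtain ⟨b₀₁, b₀₂, b₁₂, rfl⟩ := eq_mvf_of_homog_two hR
    rw [schouten_piE2_mvf]
    simpa [tD_zero] using mvf_mem_homog_three _
  · have h : ∀ I : Finset (Fin 3), I.card < 3 → R I = 0 := fun I hI => hR I (by omega)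
    have : schouten piE2 R = 0 := by
      rw [eq_mvf R, schouten_piE2_mvf, h ∅ (by decide), h {0} (by decide), h {1} (by decide),
        h {2} (by decide), h {0, 1} (by decide), h {0, 2} (by decide), h {1, 2} (by decide),
        zero_eq_mvf]
      simp [tD_zero]
    rw [this]
    exact zero_mem _

/-- Only `Q` has to be checked to be a cocycle: `P` is then closed by `d_π² = 0`. Each relation thus
reduces to naming a primitive `R`. -/
lemma sameClass_of_eq_add {k : ℕ} {P Q R : MultiVF 3} (hQ : Q ∈ cocycles piE2 (k + 1))
    (hR : R ∈ homog 3 k) (h : P = Q + schouten piE2 R) : SameClass piE2 (k + 1) P Q := by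
  have hP' : P ∈ cocycles piE2 (k + 1) :=
    ⟨h ▸ add_mem hQ.1 (schouten_piE2_mem_homog hR),
      by rw [h, schouten_add, hQ.2, schouten_piE2_schouten_piE2, add_zero]⟩
  exact ⟨_, ⟨hP', rfl⟩, Represents.of_eq_add ⟨hP', rfl⟩ hQ hR h⟩

end complex

/-! ### Computation of the cohomology groups. -/

section cohomology

/-- Every `1`-cocycle is cohomologous to `a E + b ∂_z` with Casimirs `a` and `b`. -/
lemma exists_eq_vec_add {P : MultiVF 3} (hP : P ∈ cocycles piE2 1) :
    ∃ a ∈ casimirs piE2, ∃ b ∈ casimirs piE2, ∃ R ∈ homog 3 0,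
      P = vec a b + schouten piE2 R := by
  obtain ⟨a₀, a₁, b, rfl⟩ := eq_mvf_of_homog_one hP.1
  have hd := hP.2
  rw [schouten_piE2_mvf, zero_eq_mvf, mvf_eq_iff] at hd
  obtain ⟨-, -, -, -, h01, h02, h12, -⟩ := hd
  -- The `∂_x ∧ ∂_y` component of closedness is `x ∂_z a₀ + y ∂_z a₁ = 0`, so the `z`-derivative of
  -- the planar part is `α T`.
  obtain ⟨α, hα1, hα0⟩ := exists_of_coord_mul_eq (i := (0 : Fin 3)) (j := 1) (f := pd 2 a₁)
    (g := -pd 2 a₀) (by decide) (by linear_combination -h01)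
  -- With `∂_z f = γ` and `∂_z γ = α`, subtracting `d_π f = γ T - T(f) ∂_z` makes the planar part
  -- `(A₀, A₁)` independent of `z` and replaces `b` by `b + T f`, whose `z`-derivative is `β`.
  have hγ := pd_antiD 2 α
  set γ := antiD 2 α
  have hf := pd_antiD 2 γ
  set f := antiD 2 γ
  set β := pd 2 b + tD γ with hβ
  have hA0 : pd 2 (a₀ + coord 1 * γ) = 0 := by
    rw [map_add, pd_mul, hγ, pd_two_coord_one]; linear_combination -hα0
  have hA1 : pd 2 (a₁ - coord 0 * γ) = 0 := by
    rw [map_sub, pd_mul, hγ, pd_two_coord_zero]; linear_combination hα1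
  have e0 : tD (a₀ + coord 1 * γ) + (a₁ - coord 0 * γ) = coord 1 * β := by
    rw [tD_add, tD_mul, tD_coord_one]; linear_combination h02
  have e1 : tD (a₁ - coord 0 * γ) - (a₀ + coord 1 * γ) = -(coord 0 * β) := by
    rw [tD_sub, tD_mul, tD_coord_zero]; linear_combination h12
  set A₀ := a₀ + coord 1 * γ with hA0'
  set A₁ := a₁ - coord 0 * γ with hA1'
  have hβ2 : pd 2 β = 0 := by
    refine eq_zero_of_coord_mul (i := 1) ?_
    have := congrArg (pd 2) e0
    rw [map_add, pd_two_tD, hA0, hA1, tD_zero, pd_mul, pd_two_coord_one] at this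
    linear_combination -this
  obtain ⟨m, u, hm, -, hu2, hmu⟩ := exists_average β hβ2
  -- Pairing `e0` and `e1` with `T` gives `ρ β = T(y A₀ - x A₁)`. Hence `ρ m` is both invariant and
  -- in the image of `T`, so it is zero.
  have hm0 : m = 0 := by
    refine eq_zero_of_rho_mul (eq_zero_of_tD (f := coord 1 * A₀ - coord 0 * A₁ - rho * u)
      (by rw [tD_mul, hm, tD_rho]; ring) ?_)
    rw [tD_sub, tD_sub, tD_mul, tD_mul, tD_mul, tD_rho, tD_coord_zero, tD_coord_one]
    have : rho * m = rho * (β - tD u) := by rw [hmu]; ring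
    rw [this, rho]
    linear_combination coord 1 * e0 - coord 0 * e1
  rw [hm0, zero_add] at hmu
  -- Since `β = T u`, the field `(A₀ - y u, A₁ + x u)` is invariant; this correction corresponds to
  -- the primitive `-zu`.
  obtain ⟨a, c, ha, hc, ha', hc', ha2, hc2⟩ := exists_of_invariant_vector
    (m := A₀ - coord 1 * u) (n := A₁ + coord 0 * u)
    (by rw [tD_sub, tD_mul, tD_coord_one, ← hmu]; linear_combination e0)
    (by rw [tD_add, tD_mul, tD_coord_zero, ← hmu]; linear_combination e1)
    (by rw [map_sub, pd_mul, hA0, hu2, pd_two_coord_one]; ring)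
    (by rw [map_add, pd_mul, hA1, hu2, pd_two_coord_zero]; ring)
  obtain ⟨b₀, v, hb, hb2, hv2, hbv⟩ := exists_average (b + tD f - coord 2 * tD u)
    (by rw [map_sub, map_add, pd_two_tD, hf, pd_mul, pd_two_tD, hu2, tD_zero, pd_two_coord_two,
          ← hmu, hβ]; ring)
  -- The terms of the primitive remove, in turn, the dependence on `z`, the non-invariant planar
  -- part, the part `cT = d_π(zc)`, and the part `(T v) ∂_z = d_π(-v)`.
  refine ⟨a, mem_casimirs_iff.2 ⟨ha', ha2⟩, b₀, mem_casimirs_iff.2 ⟨hb, hb2⟩,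
    mvf (f - coord 2 * u + coord 2 * c - v) 0 0 0 0 0 0 0, mvf_mem_homog_zero _, ?_⟩
  rw [vec_eq_mvf, schouten_piE2_mvf, mvf_add, mvf_eq_iff]
  simp only [tD_add, tD_sub, tD_mul, tD_zero, tD_coord_two, map_add, map_sub, map_zero, pd_mul,
    pd_two_coord_two, hf, hu2, hc2, hv2, hc']
  refine ⟨by ring, ?_, ?_, ?_, by ring, by ring, by ring, by ring⟩
  · linear_combination ha - hA0'
  · linear_combination hc - hA1'
  · linear_combination hbv

/-- A `2`-cocycle has a representative `f(x² + y²) E ∧ ∂_z + g(z) ∂_x ∧ ∂_y`. -/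
lemma exists_eq_biv_add {P : MultiVF 3} (hP : P ∈ cocycles piE2 2) :
    ∃ a ∈ casimirs piE2, ∃ g : SmoothLine, ∃ R ∈ homog 3 1,
      P = biv a (axial g) + schouten piE2 R := by
  obtain ⟨α, b₀, b₁, rfl⟩ := eq_mvf_of_homog_two hP.1
  have hd := hP.2
  rw [schouten_piE2_mvf, zero_eq_mvf, mvf_eq_iff] at hd
  obtain ⟨-, -, -, -, -, -, -, hd⟩ := hd
  -- Off its axis values `α` equals `x p + y q`, which is the `∂_x ∧ ∂_y` component of `d_π(-p' ∂_x
  -- - q' ∂_y)` for the antiderivatives `p'`, `q'` in `z`.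
  obtain ⟨p, q, hpq⟩ := exists_eq_of_axis (w := α - axial (axisPart α))
    fun z => by rw [val_sub, axial_axisPart_val, sub_self]
  have hg := tD_axial (axisPart α)
  have hTα : tD α = tD (coord 0 * p + coord 1 * q) := by rw [← hpq, tD_sub, hg, sub_zero]
  rw [tD_add, tD_mul, tD_mul, tD_coord_zero, tD_coord_one] at hTα
  have hp2 := pd_antiD 2 p
  have hq2 := pd_antiD 2 q
  set p' := antiD 2 p
  set q' := antiD 2 q
  -- After that correction closedness is again a Koszul relation: the `z`-derivative of the
  -- remaining planar field is `β T`, and `d_π(r ∂_z) = γ T ∧ ∂_z` removes it.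
  obtain ⟨β, hβ1, hβ0⟩ := exists_of_coord_mul_eq (i := (0 : Fin 3)) (j := 1)
    (f := pd 2 b₁ + tD q - p) (g := -(pd 2 b₀ + tD p + q)) (by decide)
    (by linear_combination -hd - hTα)
  have hγ := pd_antiD 2 β
  set γ := antiD 2 β
  have hr := pd_antiD 2 γ
  set r := antiD 2 γ
  obtain ⟨m, n, u, v, hm, hn, hm2, hn2, hu2, hv2, h0, h1⟩ :=
    exists_average_vector (b₀ + tD p' + q' + coord 1 * γ) (b₁ + tD q' - p' - coord 0 * γ)
      (by rw [map_add, map_add, map_add, pd_two_tD, pd_mul, hp2, hq2, hγ, pd_two_coord_one]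
          linear_combination -hβ0)
      (by rw [map_sub, map_sub, map_add, pd_two_tD, pd_mul, hp2, hq2, hγ, pd_two_coord_zero]
          linear_combination hβ1)
  obtain ⟨a, c, rfl, rfl, ha, hc, ha2, hc2⟩ := exists_of_invariant_vector hm hn hm2 hn2
  -- The field left over is independent of `z`. Its averaging error is the contribution of `u ∂_x +
  -- v ∂_y`, and its part `c T ∧ ∂_z` is `d_π(zc ∂_z)`.
  refine ⟨a, mem_casimirs_iff.2 ⟨ha, ha2⟩, axisPart α,
    mvf 0 (u - p') (v - q') (r + coord 2 * c) 0 0 0 0, mvf_mem_homog_one _ _ _, ?_⟩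
  rw [biv_eq_mvf, schouten_piE2_mvf, mvf_add, mvf_eq_iff]
  simp only [tD_sub, tD_zero, map_add, map_sub, map_zero, pd_mul, pd_two_coord_two, hu2, hv2, hc2,
    hp2, hq2, hr]
  refine ⟨by ring, by ring, by ring, by ring, ?_, ?_, ?_, by ring⟩
  · linear_combination hpq
  · linear_combination h0
  · linear_combination h1

/-- A function vanishing on the axis is `x p + y q`; the primitive is built from antiderivatives of
`p` and `q` in `z`. -/
lemma exists_eq_tri_add {f : Smooth 3} {g : Smooth 3} (h : ∀ z, (f - g).1 ![0, 0, z] = 0) :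
    ∃ R ∈ homog 3 2, tri f = tri g + schouten piE2 R := by
  obtain ⟨p, q, hpq⟩ := exists_eq_of_axis h
  refine ⟨mvf 0 0 0 0 0 (-antiD 2 p) (-antiD 2 q) 0, mvf_mem_homog_two _ _ _, ?_⟩
  rw [tri_eq_mvf, tri_eq_mvf, schouten_piE2_mvf, mvf_add, mvf_eq_iff]
  simp only [tD_zero, map_zero, map_neg, pd_antiD]
  refine ⟨by ring, by ring, by ring, by ring, by ring, by ring, by ring, ?_⟩
  linear_combination hpq

/-- The planar part of `d_π f` is a multiple of `T`, hence orthogonal to `E`, so `ρ a = 0`. Moreover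
`b = -T f` is invariant, hence zero. -/
lemma vec_eq_zero_of_coboundary {a b : Smooth 3} (hb : b ∈ casimirs piE2)
    (h : vec a b ∈ coboundaries piE2 1) : a = 0 ∧ b = 0 := by
  rw [mem_casimirs_iff] at hb
  obtain ⟨R, hR, h⟩ := mem_coboundaries_succ h
  obtain ⟨f, rfl⟩ := eq_mvf_of_homog_zero hR
  rw [vec_eq_mvf, schouten_piE2_mvf, mvf_eq_iff] at h
  obtain ⟨-, h0, h1, h2, -⟩ := h
  refine ⟨eq_zero_of_rho_mul ?_, eq_zero_of_tD (f := -f) hb.1 (by rw [tD_neg, h2])⟩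
  rw [rho]
  linear_combination coord 0 * h0 + coord 1 * h1

/-- Pairing the planar part with `E` eliminates `∂_z b` and leaves `ρ a = T(x a₀ + y a₁)`, an
invariant function in the image of `T`. The `∂_x ∧ ∂_y` component carries a factor `x` or `y` in
each term. -/
lemma biv_eq_zero_of_coboundary {a k : Smooth 3} (ha : a ∈ casimirs piE2)
    (h : biv a k ∈ coboundaries piE2 2) : a = 0 ∧ ∀ z, k.1 ![0, 0, z] = 0 := by
  rw [mem_casimirs_iff] at ha
  obtain ⟨R, hR, h⟩ := mem_coboundaries_succ h
  obtain ⟨a₀, a₁, b, rfl⟩ := eq_mvf_of_homog_one hR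
  rw [biv_eq_mvf, schouten_piE2_mvf, mvf_eq_iff] at h
  obtain ⟨-, -, -, -, h01, h02, h12, -⟩ := h
  refine ⟨eq_zero_of_rho_mul (eq_zero_of_tD (f := coord 0 * a₀ + coord 1 * a₁)
    (by rw [tD_mul, tD_rho, ha.1]; ring) ?_), fun z => by rw [h01]; simp⟩
  rw [tD_add, tD_mul, tD_mul, tD_coord_zero, tD_coord_one, rho]
  linear_combination -coord 0 * h02 - coord 1 * h12

/-- Every term of `d_π` on bivector fields, including `T b₀₁`, carries a factor `x` or `y`. -/
lemma axis_eq_zero_of_tri_coboundary {k : Smooth 3} (h : tri k ∈ coboundaries piE2 3) :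
    ∀ z, k.1 ![0, 0, z] = 0 := by
  obtain ⟨R, hR, h⟩ := mem_coboundaries_succ h
  obtain ⟨α, b₀, b₁, rfl⟩ := eq_mvf_of_homog_two hR
  rw [tri_eq_mvf, schouten_piE2_mvf, mvf_eq_iff] at h
  intro z
  rw [h.2.2.2.2.2.2.2]
  simp [tD]

lemma exists_unique_casimir (c : H piE2 0) :
    ∃! f : SmoothHalfLine, Represents (ofFun (radial f)) c := by
  obtain ⟨P, hP, hc⟩ := exists_represents c
  obtain ⟨u, rfl⟩ := eq_mvf_of_homog_zero hP.1
  rw [← ofFun_eq_mvf] at hP hc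
  have hu := mem_casimirs_iff.1 (show u ∈ casimirs piE2 from hP.2)
  obtain ⟨f, rfl⟩ := exists_eq_radial hu.1 hu.2
  refine ⟨f, hc, fun f' hf' => radial_injective ?_⟩
  have := mem_coboundaries_zero (hf'.sub_mem hc)
  exact sub_eq_zero.1 (congrFun this ∅)

lemma radial_mem_casimirs (f : SmoothHalfLine) : radial f ∈ casimirs piE2 :=
  mem_casimirs_iff.2 ⟨tD_radial f, pd_two_radial f⟩

lemma exists_unique_biv (c : H piE2 2) :
    ∃! q : SmoothHalfLine × SmoothLine, Represents (biv (radial q.1) (axial q.2)) c := by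
  obtain ⟨P, hP, hc⟩ := exists_represents c
  obtain ⟨a, ha, g, R, hR, h⟩ := exists_eq_biv_add hP
  obtain ⟨f, rfl⟩ := exists_eq_radial (mem_casimirs_iff.1 ha).1 (mem_casimirs_iff.1 ha).2
  have hc' := hc.of_eq_add (biv_mem_cocycles (pd_two_radial f) (tD_axial g)) hR h
  refine ⟨(f, g), hc', fun ⟨f', g'⟩ h' => ?_⟩
  have h1 := h'.sub_mem hc'
  have h2 : biv (radial f') (axial g') - biv (radial f) (axial g) =
      biv (radial f' - radial f) (axial g' - axial g) := by
    simp only [biv, sub_smul]; abel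
  rw [h2] at h1
  obtain ⟨h3, h4⟩ := biv_eq_zero_of_coboundary
    (sub_mem (radial_mem_casimirs f') (radial_mem_casimirs f)) h1
  exact Prod.ext (radial_injective (sub_eq_zero.1 h3)) (axial_injective h4)

lemma exists_unique_tri (c : H piE2 3) : ∃! g : SmoothLine, Represents (tri (axial g)) c := by
  obtain ⟨P, hP, hc⟩ := exists_represents c
  obtain ⟨k, rfl⟩ := eq_mvf_of_homog_three hP.1
  rw [← tri_eq_mvf] at hP hc
  obtain ⟨R, hR, h⟩ := exists_eq_tri_add (f := k) (g := axial (axisPart k))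
    fun z => by rw [val_sub, axial_axisPart_val, sub_self]
  have hc' := hc.of_eq_add (tri_mem_cocycles _) hR h
  refine ⟨_, hc', fun g' h' => ?_⟩
  have h1 := h'.sub_mem hc'
  have h2 : ∀ f g, tri f - tri g = tri (f - g) := fun f g => (sub_smul f g dxyz).symm
  rw [h2] at h1
  exact axial_injective (axis_eq_zero_of_tri_coboundary h1)

lemma exists_basis : ∃ b : Module.Basis (Fin 2) (casimirs piE2) (H piE2 1),
    Represents vfE (b 0) ∧ Represents vfZ (b 1) := by
  have h10 : vec 1 0 = vfE := by simp [vec]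
  have h01 : vec 0 1 = vfZ := by simp [vec]
  have hE : vfE ∈ cocycles piE2 1 := h10 ▸ vec_mem_cocycles (one_mem _) (zero_mem _)
  have hZ : vfZ ∈ cocycles piE2 1 := h01 ▸ vec_mem_cocycles (zero_mem _) (one_mem _)
  let e : Fin 2 → H piE2 1 := ![Submodule.Quotient.mk ⟨vfE, hE⟩, Submodule.Quotient.mk ⟨vfZ, hZ⟩]
  have hrep : ∀ a b : casimirs piE2, Represents (vec a b) (a • e 0 + b • e 1) := fun a b =>
    ⟨vec_mem_cocycles a.2 b.2, rfl⟩
  have hli : LinearIndependent (casimirs piE2) e := by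
    refine LinearIndependent.pair_iff.2 fun a b hab => ?_
    have h1 := hrep a b
    have h0 := hrep 0 0
    have h2 : (0 : casimirs piE2) • e 0 + (0 : casimirs piE2) • e 1 = a • e 0 + b • e 1 := by
      rw [zero_smul, zero_smul, add_zero]; exact hab.symm
    rw [h2] at h0
    have h3 := h1.sub_mem h0
    have h4 : vec ((0 : casimirs piE2) : Smooth 3) ((0 : casimirs piE2) : Smooth 3) = 0 := by
      simp [vec]
    rw [h4, sub_zero] at h3
    obtain ⟨ha, hb⟩ := vec_eq_zero_of_coboundary b.2 h3
    exact ⟨Subtype.ext ha, Subtype.ext hb⟩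
  have hsp : ⊤ ≤ Submodule.span (casimirs piE2) (Set.range e) := by
    rintro c -
    obtain ⟨P, hP, hc⟩ := exists_represents c
    obtain ⟨a, ha, b, hb, R, hR, h⟩ := exists_eq_vec_add hP
    obtain ⟨h1, hc'⟩ := hc.of_eq_add (vec_mem_cocycles ha hb) hR h
    obtain ⟨h2, hr⟩ := hrep ⟨a, ha⟩ ⟨b, hb⟩
    rw [← hc', show (Submodule.Quotient.mk ⟨vec a b, h1⟩ : H piE2 1) = _ from hr]
    exact add_mem (Submodule.smul_mem _ _ (Submodule.subset_span ⟨0, rfl⟩))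
      (Submodule.smul_mem _ _ (Submodule.subset_span ⟨1, rfl⟩))
  refine ⟨Module.Basis.mk hli hsp, ?_, ?_⟩
  · rw [Module.Basis.mk_apply]; exact ⟨hE, rfl⟩
  · rw [Module.Basis.mk_apply]; exact ⟨hZ, rfl⟩

end cohomology

/-! ### Relations, wedge products and brackets in cohomology. -/

section relations

/-- The difference `k - k'` is `ρ w` with `w` invariant. If `∂_z W = w` with `W` invariant, then
`d_π(-W E) = ρ w ∂_x ∧ ∂_y`; invariance of `W E` kills the other components. -/
lemma biv_sameClass {c k k' : Smooth 3} (hc : pd 2 c = 0) (hk : tD k = 0) (hk' : tD k' = 0)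
    (h : ∀ z, (k - k').1 ![0, 0, z] = 0) : SameClass piE2 2 (biv c k) (biv c k') := by
  obtain ⟨w, hw, hw'⟩ := exists_eq_rho_mul (w := k - k') (by rw [tD_sub, hk, hk', sub_zero]) h
  have hT : tD (antiD 2 w) = 0 := by rw [tD_antiD, hw', antiD_zero]
  refine sameClass_of_eq_add (biv_mem_cocycles hc hk')
    (mvf_mem_homog_one (-(coord 0 * antiD 2 w)) (-(coord 1 * antiD 2 w)) 0) ?_
  rw [biv_eq_mvf, biv_eq_mvf, schouten_piE2_mvf, mvf_add, mvf_eq_iff]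
  simp only [tD_neg, tD_mul, tD_zero, tD_coord_zero, tD_coord_one, hT, map_neg, map_zero, pd_mul,
    pd_antiD, pd_two_coord_zero, pd_two_coord_one]
  refine ⟨by ring, by ring, by ring, by ring, ?_, by ring, by ring, by ring⟩
  rw [rho] at hw
  linear_combination hw

lemma tri_sameClass {k k' : Smooth 3} (h : ∀ z, (k - k').1 ![0, 0, z] = 0) :
    SameClass piE2 3 (tri k) (tri k') := by
  obtain ⟨R, hR, h⟩ := exists_eq_tri_add h
  exact sameClass_of_eq_add (tri_mem_cocycles k') hR h

lemma axis_val_of_casimir {u : Smooth 3} (hu : u ∈ casimirs piE2) (z : ℝ) :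
    u.1 ![0, 0, z] = atZero u := by
  rw [mem_casimirs_iff] at hu
  rw [val_eq_of_pd_eq_zero hu.2]
  refine congrArg u.1 ?_
  ext i; fin_cases i <;> simp

lemma radialZ_dxy_sameClass (h : SmoothHalfPlane) :
    SameClass piE2 2 (radialZ h • dxy) (axial (onAxis h) • dxy) := by
  have e : ∀ k, biv 0 k = k • dxy := fun k => by rw [biv, zero_smul, zero_add]
  rw [← e, ← e]
  exact biv_sameClass (map_zero _) (tD_radialZ h) (tD_axial _) fun z => by
    rw [val_sub]; simp [radialZ, axial, onAxis]

lemma radialZ_dxyz_sameClass (h : SmoothHalfPlane) :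
    SameClass piE2 3 (radialZ h • dxyz) (axial (onAxis h) • dxyz) :=
  tri_sameClass fun z => by
    rw [val_sub]; simp [radialZ, axial, onAxis]

/-- For a gradient `k · (x, y)` one has `E(u) = ρ k`, a product of Casimirs. -/
lemma eulerD_mem_casimirs {u : Smooth 3} (hu : u ∈ casimirs piE2) :
    eulerD u ∈ casimirs piE2 := by
  rw [mem_casimirs_iff] at hu
  obtain ⟨k, h0, h1, hk⟩ := exists_gradient_eq hu.1
  have e : eulerD u = rho * k := by rw [eulerD, h0, h1, rho]; ring
  rw [mem_casimirs_iff, e, tD_mul, pd_mul, tD_rho, pd_two_rho, hk, pd_two_gradient hu.2 h0]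
  simp

lemma eulerD_axis (f : Smooth 3) (z : ℝ) : (eulerD f).1 ![0, 0, z] = 0 := by simp [eulerD]

lemma tD_pd_two_axial (g : SmoothLine) : tD (pd 2 (axial g)) = 0 := by
  rw [← pd_two_tD, tD_axial, map_zero]

section products

variable {u a b a' b' c c' : Smooth 3}

lemma smul_biv_sameClass (hu : u ∈ casimirs piE2) (hc : c ∈ casimirs piE2) (g : SmoothLine) :
    SameClass piE2 2 (u • biv c (axial g)) (biv (u * c) (atZero u • axial g)) := by
  have e : u • biv c (axial g) = biv (u * c) (u * axial g) := by
    rw [biv, biv, smul_add, smul_smul, smul_smul]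
  have h := mem_casimirs_iff.1 hu
  rw [e]
  refine biv_sameClass (mem_casimirs_iff.1 (mul_mem hu hc)).2 ?_ ?_ fun z => ?_
  · rw [tD_mul, h.1, tD_axial]; ring
  · rw [tD_smul, tD_axial, smul_zero]
  · simp [axis_val_of_casimir hu]

lemma smul_tri_sameClass (hu : u ∈ casimirs piE2) (g : SmoothLine) :
    SameClass piE2 3 (u • tri (axial g)) (tri (atZero u • axial g)) := by
  have e : u • tri (axial g) = tri (u * axial g) := by rw [tri, tri, smul_smul]
  rw [e]
  exact tri_sameClass fun z => by simp [axis_val_of_casimir hu]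

lemma wedge_vec_vec_sameClass (ha : a ∈ casimirs piE2) (hb : b ∈ casimirs piE2)
    (ha' : a' ∈ casimirs piE2) (hb' : b' ∈ casimirs piE2) :
    SameClass piE2 2 (wedge (vec a b) (vec a' b')) (biv (a * b' - b * a') 0) := by
  have e : wedge (vec a b) (vec a' b') = biv (a * b' - b * a') 0 := by
    rw [vec_eq_mvf, vec_eq_mvf, biv_eq_mvf, wedge_mvf, mvf_eq_iff]
    refine ⟨?_, ?_, ?_, ?_, ?_, ?_, ?_, ?_⟩ <;> ring
  rw [e]
  exact .refl (biv_mem_cocycles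
    (mem_casimirs_iff.1 (sub_mem (mul_mem ha hb') (mul_mem hb ha'))).2 tD_zero)

lemma wedge_vec_biv_sameClass (hb : b ∈ casimirs piE2) (g : SmoothLine) :
    SameClass piE2 3 (wedge (vec a b) (biv c (axial g))) (tri (atZero b • axial g)) := by
  have e : wedge (vec a b) (biv c (axial g)) = tri (b * axial g) := by
    rw [vec_eq_mvf, biv_eq_mvf, tri_eq_mvf, wedge_mvf, mvf_eq_iff]
    refine ⟨?_, ?_, ?_, ?_, ?_, ?_, ?_, ?_⟩ <;> ring
  rw [e]
  exact tri_sameClass fun z => by simp [axis_val_of_casimir hb]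

end products

section brackets

variable {u a b a' b' c c' : Smooth 3}

lemma schouten_vec_ofFun_sameClass (ha : a ∈ casimirs piE2) (hu : u ∈ casimirs piE2) :
    SameClass piE2 0 (schouten (vec a b) (ofFun u)) (ofFun (a * eulerD u)) := by
  have h := (mem_casimirs_iff.1 hu).2
  have e : schouten (vec a b) (ofFun u) = ofFun (a * eulerD u) := by
    simp only [vec_eq_mvf, ofFun_eq_mvf, schouten, Fin.sum_univ_three, leftD_mvf_0, leftD_mvf_1,
      leftD_mvf_2, rightD_mvf_0, rightD_mvf_1, rightD_mvf_2, coeffD_mvf, wedge_mvf, mvf_add,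
      mvf_sub, mvf_eq_iff, h, map_zero, eulerD]
    refine ⟨?_, ?_, ?_, ?_, ?_, ?_, ?_, ?_⟩ <;> ring
  rw [e]
  exact .refl (ofFun_mem_cocycles (mul_mem ha (eulerD_mem_casimirs hu)))

lemma schouten_ofFun_biv_sameClass (hu : u ∈ casimirs piE2) (hc : c ∈ casimirs piE2)
    (g : SmoothLine) : SameClass piE2 1 (schouten (ofFun u) (biv c (axial g)))
      (vec 0 (-(c * eulerD u))) := by
  have h := mem_casimirs_iff.1 hu
  obtain ⟨k, h0, h1, hk⟩ := exists_gradient_eq h.1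
  have hk2 := pd_two_gradient h.2 h0
  -- Here `[u, g ∂_x ∧ ∂_y] = -g k T`, which is `d_π(-G k)` for an antiderivative `G` of `g`.
  refine sameClass_of_eq_add
    (vec_mem_cocycles (zero_mem _) (neg_mem (mul_mem hc (eulerD_mem_casimirs hu))))
    (mvf_mem_homog_zero (-(antiD 2 (axial g) * k))) ?_
  rw [schouten_piE2_mvf]
  simp only [vec_eq_mvf, biv_eq_mvf, ofFun_eq_mvf, schouten, Fin.sum_univ_three, leftD_mvf_0,
    leftD_mvf_1, leftD_mvf_2, rightD_mvf_0, rightD_mvf_1, rightD_mvf_2, coeffD_mvf, wedge_mvf,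
    mvf_add, mvf_sub, mvf_eq_iff, h, h0, h1, hk, hk2, map_zero, map_neg, eulerD, tD_neg, tD_mul,
    tD_zero, tD_antiD, tD_axial, antiD_zero, pd_mul, pd_antiD]
  refine ⟨?_, ?_, ?_, ?_, ?_, ?_, ?_, ?_⟩ <;> ring

lemma schouten_ofFun_tri_sameClass (hu : u ∈ casimirs piE2) (g : SmoothLine) :
    SameClass piE2 2 (schouten (ofFun u) (tri (axial g))) 0 := by
  have h := mem_casimirs_iff.1 hu
  obtain ⟨k, h0, h1, hk⟩ := exists_gradient_eq h.1
  have hk2 := pd_two_gradient h.2 h0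
  -- The bracket is `-g k T ∧ ∂_z = d_π(-G k ∂_z)` with `G` an antiderivative of `g`.
  refine sameClass_of_eq_add (zero_mem _)
    (mvf_mem_homog_one 0 0 (-(antiD 2 (axial g) * k))) ?_
  rw [schouten_piE2_mvf, zero_add]
  simp only [tri_eq_mvf, ofFun_eq_mvf, schouten, Fin.sum_univ_three, leftD_mvf_0,
    leftD_mvf_1, leftD_mvf_2, rightD_mvf_0, rightD_mvf_1, rightD_mvf_2, coeffD_mvf, wedge_mvf,
    mvf_add, mvf_sub, mvf_eq_iff, h, h0, h1, hk2, map_zero, map_neg, tD_zero, pd_mul, pd_antiD]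
  refine ⟨?_, ?_, ?_, ?_, ?_, ?_, ?_, ?_⟩ <;> ring

lemma schouten_vec_vec_sameClass (ha : a ∈ casimirs piE2) (hb : b ∈ casimirs piE2)
    (ha' : a' ∈ casimirs piE2) (hb' : b' ∈ casimirs piE2) :
    SameClass piE2 1 (schouten (vec a b) (vec a' b'))
      (vec (a * eulerD a' - a' * eulerD a) (a * eulerD b' - a' * eulerD b)) := by
  have e : schouten (vec a b) (vec a' b') =
      vec (a * eulerD a' - a' * eulerD a) (a * eulerD b' - a' * eulerD b) := by
    simp only [vec_eq_mvf, schouten, Fin.sum_univ_three, leftD_mvf_0, leftD_mvf_1,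
      leftD_mvf_2, rightD_mvf_0, rightD_mvf_1, rightD_mvf_2, coeffD_mvf, wedge_mvf, mvf_add,
      mvf_sub, mvf_eq_iff, (mem_casimirs_iff.1 ha).2, (mem_casimirs_iff.1 hb).2,
      (mem_casimirs_iff.1 ha').2, (mem_casimirs_iff.1 hb').2, map_zero, eulerD, pd_mul, pd_coord]
    refine ⟨?_, ?_, ?_, ?_, ?_, ?_, ?_, ?_⟩ <;> simp <;> ring
  rw [e]
  exact .refl (vec_mem_cocycles
    (sub_mem (mul_mem ha (eulerD_mem_casimirs ha')) (mul_mem ha' (eulerD_mem_casimirs ha)))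
    (sub_mem (mul_mem ha (eulerD_mem_casimirs hb')) (mul_mem ha' (eulerD_mem_casimirs hb))))

lemma schouten_vec_biv_sameClass (ha : a ∈ casimirs piE2) (hb : b ∈ casimirs piE2)
    (hc : c ∈ casimirs piE2) (g : SmoothLine) :
    SameClass piE2 2 (schouten (vec a b) (biv c (axial g)))
      (biv (a * eulerD c - c * eulerD a)
        (atZero b • pd 2 (axial g) - (2 * atZero a) • axial g)) := by
  have h := mem_casimirs_iff.1 hb
  obtain ⟨k, h0, h1, hk⟩ := exists_gradient_eq h.1
  have hk2 := pd_two_gradient h.2 h0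
  have hE := mem_casimirs_iff.1
    (sub_mem (mul_mem ha (eulerD_mem_casimirs hc)) (mul_mem hc (eulerD_mem_casimirs ha)))
  have ht : tD (b * pd 2 (axial g) - (2 * a + eulerD a) * axial g) = 0 := by
    have h2 : tD (2 : Smooth 3) = 0 := by
      rw [← one_add_one_eq_two, tD_add]; simp [tD]
    rw [tD_sub, tD_mul, tD_mul, tD_add, tD_mul, h.1, h2, tD_pd_two_axial, tD_axial,
      (mem_casimirs_iff.1 ha).1, (mem_casimirs_iff.1 (eulerD_mem_casimirs ha)).1]
    ring
  -- The derivatives of `b` contribute `g k T ∧ ∂_z`, which is exact. In the remaining coefficient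
  -- of `∂_x ∧ ∂_y`, `2a + E(a)` is the planar divergence of `aE`; only its axis value `2a₀`
  -- matters.
  refine SameClass.trans (Q := biv (a * eulerD c - c * eulerD a)
    (b * pd 2 (axial g) - (2 * a + eulerD a) * axial g))
    (sameClass_of_eq_add (biv_mem_cocycles hE.2 ht)
      (mvf_mem_homog_one 0 0 (antiD 2 (axial g) * k)) ?_)
    (biv_sameClass hE.2 ht ?_ fun z => ?_)
  · rw [schouten_piE2_mvf]
    simp only [vec_eq_mvf, biv_eq_mvf, schouten, Fin.sum_univ_three, leftD_mvf_0,
      leftD_mvf_1, leftD_mvf_2, rightD_mvf_0, rightD_mvf_1, rightD_mvf_2, coeffD_mvf, wedge_mvf,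
      mvf_add, mvf_sub, mvf_eq_iff, h, h0, h1, hk2, (mem_casimirs_iff.1 ha).2,
      (mem_casimirs_iff.1 hc).2, pd_zero_axial, pd_one_axial, map_zero, tD_zero, pd_mul, pd_antiD,
      pd_coord, eulerD]
    refine ⟨?_, ?_, ?_, ?_, ?_, ?_, ?_, ?_⟩ <;> simp <;> ring
  · rw [tD_sub, tD_smul, tD_smul, tD_pd_two_axial, tD_axial]; simp
  · simp only [val_sub, val_mul, val_add, val_smul, eulerD_axis, axis_val_of_casimir ha,
      axis_val_of_casimir hb]
    change _ - (2 * _ + _) * _ - _ = (0 : ℝ)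
    ring

lemma schouten_vec_tri_sameClass (ha : a ∈ casimirs piE2) (hb : b ∈ casimirs piE2)
    (g : SmoothLine) : SameClass piE2 3 (schouten (vec a b) (tri (axial g)))
      (tri (atZero b • pd 2 (axial g) - (2 * atZero a) • axial g)) := by
  have e : schouten (vec a b) (tri (axial g)) =
      tri (b * pd 2 (axial g) - (2 * a + eulerD a) * axial g) := by
    simp only [vec_eq_mvf, tri_eq_mvf, schouten, Fin.sum_univ_three, leftD_mvf_0,
      leftD_mvf_1, leftD_mvf_2, rightD_mvf_0, rightD_mvf_1, rightD_mvf_2, coeffD_mvf, wedge_mvf,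
      mvf_add, mvf_sub, mvf_eq_iff, (mem_casimirs_iff.1 hb).2, (mem_casimirs_iff.1 ha).2,
      pd_zero_axial, pd_one_axial, map_zero, pd_mul, pd_coord, eulerD]
    refine ⟨?_, ?_, ?_, ?_, ?_, ?_, ?_, ?_⟩ <;> simp
    ring
  rw [e]
  refine tri_sameClass fun z => ?_
  simp only [val_sub, val_mul, val_add, val_smul, eulerD_axis, axis_val_of_casimir ha,
    axis_val_of_casimir hb]
  change _ - (2 * _ + _) * _ - _ = (0 : ℝ)
  ring

lemma schouten_biv_biv_sameClass (hc : c ∈ casimirs piE2) (hc' : c' ∈ casimirs piE2)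
    (g g' : SmoothLine) : SameClass piE2 3 (schouten (biv c (axial g)) (biv c' (axial g')))
      (tri ((2 * atZero c) • axial g' + (2 * atZero c') • axial g)) := by
  -- The factors `2c + E(c)` and `2c' + E(c')` are planar divergences of `cE` and `c'E`; on the axis
  -- they reduce to `2c₀` and `2c'₀`.
  have e : schouten (biv c (axial g)) (biv c' (axial g')) =
      tri ((2 * c + eulerD c) * axial g' + (2 * c' + eulerD c') * axial g) := by
    simp only [biv_eq_mvf, tri_eq_mvf, schouten, Fin.sum_univ_three, leftD_mvf_0,
      leftD_mvf_1, leftD_mvf_2, rightD_mvf_0, rightD_mvf_1, rightD_mvf_2, coeffD_mvf, wedge_mvf,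
      mvf_add, mvf_sub, mvf_eq_iff, (mem_casimirs_iff.1 hc).2, (mem_casimirs_iff.1 hc').2,
      pd_zero_axial, pd_one_axial, map_zero, pd_mul, pd_coord, eulerD]
    refine ⟨?_, ?_, ?_, ?_, ?_, ?_, ?_, ?_⟩ <;> simp
    ring
  rw [e]
  refine tri_sameClass fun z => ?_
  simp only [val_sub, val_mul, val_add, val_smul, eulerD_axis, axis_val_of_casimir hc,
    axis_val_of_casimir hc']
  change (2 * _ + _) * _ + (2 * _ + _) * _ - _ = (0 : ℝ)
  ring

end brackets

end relations

end PoissonCoh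

end

open PoissonCoh in
theorem mainTheorem4 :
    -- `π = T ∧ ∂_z` is a Poisson structure
    IsPoisson piE2 ∧
    -- degree 0
    ((∀ u : Smooth 3, u ∈ casimirs piE2 ↔ ∃ f : SmoothHalfLine, u = radial f) ∧
      (∀ c : H piE2 0, ∃! f : SmoothHalfLine, Represents (ofFun (radial f)) c)) ∧
    -- degree 1
    (∃ b : Module.Basis (Fin 2) (casimirs piE2) (H piE2 1),
      Represents vfE (b 0) ∧ Represents vfZ (b 1)) ∧
    -- degree 2
    ((∀ (f : SmoothHalfLine) (g : SmoothLine),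
        biv (radial f) (axial g) ∈ cocycles piE2 2) ∧
      (∀ c : H piE2 2, ∃! q : SmoothHalfLine × SmoothLine,
        Represents (biv (radial q.1) (axial q.2)) c)) ∧
    -- degree 3
    ((∀ g : SmoothLine, tri (axial g) ∈ cocycles piE2 3) ∧
      (∀ c : H piE2 3, ∃! g : SmoothLine, Represents (tri (axial g)) c)) ∧
    -- the relations describing the algebraic structure
    (∀ h : SmoothHalfPlane,
      SameClass piE2 2 (radialZ h • dxy) (axial (onAxis h) • dxy) ∧
      SameClass piE2 3 (radialZ h • dxyz) (axial (onAxis h) • dxyz)) ∧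
    -- the resulting wedge products of the representatives
    (∀ (u a b a' b' c : casimirs piE2) (g : SmoothLine),
      SameClass piE2 2 ((u : Smooth 3) • biv c (axial g))
        (biv (u * c) (atZero u • axial g)) ∧
      SameClass piE2 3 ((u : Smooth 3) • tri (axial g)) (tri (atZero u • axial g)) ∧
      SameClass piE2 2 (wedge (vec a b) (vec a' b')) (biv (a * b' - b * a') 0) ∧
      SameClass piE2 3 (wedge (vec a b) (biv c (axial g))) (tri (atZero b • axial g))) ∧
    -- the resulting Schouten-Nijenhuis brackets of the representatives
    (∀ (u a b a' b' c c' : casimirs piE2) (g g' : SmoothLine),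
      SameClass piE2 0 (schouten (vec a b) (ofFun u)) (ofFun (a * eulerD u)) ∧
      SameClass piE2 1 (schouten (ofFun (u : Smooth 3)) (biv c (axial g)))
        (vec 0 (-(c * eulerD u))) ∧
      SameClass piE2 2 (schouten (ofFun (u : Smooth 3)) (tri (axial g))) 0 ∧
      SameClass piE2 1 (schouten (vec a b) (vec a' b'))
        (vec (a * eulerD a' - a' * eulerD a) (a * eulerD b' - a' * eulerD b)) ∧
      SameClass piE2 2 (schouten (vec a b) (biv c (axial g)))
        (biv (a * eulerD c - c * eulerD a)
          (atZero b • pd 2 (axial g) - (2 * atZero a) • axial g)) ∧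
      SameClass piE2 3 (schouten (vec a b) (tri (axial g)))
        (tri (atZero b • pd 2 (axial g) - (2 * atZero a) • axial g)) ∧
      SameClass piE2 3 (schouten (biv c (axial g)) (biv c' (axial g')))
        (tri ((2 * atZero c) • axial g' + (2 * atZero c') • axial g))) := by
  refine ⟨isPoisson_piE2, ⟨fun u => ?_, exists_unique_casimir⟩, exists_basis,
    ⟨fun f g => biv_mem_cocycles (pd_two_radial f) (tD_axial g), exists_unique_biv⟩,
    ⟨fun g => tri_mem_cocycles _, exists_unique_tri⟩,
    fun h => ⟨radialZ_dxy_sameClass h, radialZ_dxyz_sameClass h⟩,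
    fun u a b a' b' c g => ⟨smul_biv_sameClass u.2 c.2 g, smul_tri_sameClass u.2 g,
      wedge_vec_vec_sameClass a.2 b.2 a'.2 b'.2, wedge_vec_biv_sameClass b.2 g⟩,
    fun u a b a' b' c c' g g' => ⟨schouten_vec_ofFun_sameClass a.2 u.2,
      schouten_ofFun_biv_sameClass u.2 c.2 g, schouten_ofFun_tri_sameClass u.2 g,
      schouten_vec_vec_sameClass a.2 b.2 a'.2 b'.2, schouten_vec_biv_sameClass a.2 b.2 c.2 g,
      schouten_vec_tri_sameClass a.2 b.2 g, schouten_biv_biv_sameClass c.2 c'.2 g g'⟩⟩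
  constructor
  · exact fun hu => exists_eq_radial (mem_casimirs_iff.1 hu).1 (mem_casimirs_iff.1 hu).2
  · rintro ⟨f, rfl⟩
    exact radial_mem_casimirs f
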